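/- Let $G$ be a locally compact second countable group and let $S(G)$ be the space of closed subgroups of $G$ with the Chabauty topology, on which $G$ acts by conjugation. A $G$-space is a standard Borel probability space $(X,\nu)$ with a Borel action of $G$ such that every $g\in G$ preserves the class of $\nu$-null sets; $\mathrm{stab}(x)=\{g\in G: gx=x\}\in S(G)$ for $x \in X$. A measurable map $f$ from $X$ to a $G$-set is equivariant if for every $g\in G$, $f(gx)=gf(x)$ for $\nu$-almost every $x$; a $G$-map $(Y,\eta)\to(X,\nu)$ of $G$-spaces is an equivariant measurable map $\pi : Y\to X$ with $\pi_*\eta=\nu$; it is relatively measure-preserving if the disintegration $D_\pi:X\to P(Y)$ of $\eta$ over $\nu$ is equivariant. Let $(X,\nu)$ be a $G$-space and let $\varphi:X\to P(S(G))$ be a measurable equivariant map such that for $\nu$-almost every $x\in X$ and $\varphi(x)$-almost every $H\in S(G)$ one has $H\le\mathrm{stab}(x)$. Then there exist a $G$-space $(Y,\eta)$ and a relatively measure-preserving $G$-map $\pi:(Y,\eta)\to(X,\nu)$ such that $\mathrm{stab}_*\eta$ is the barycenter $\int_X\varphi(x)\,d\nu(x)$ of $\varphi_*\nu$. In particular,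 for every Borel probability measure $\rho$ on $S(G)$ that is quasi-invariant under conjugation (a quasi-invariant random subgroup) there exists a $G$-space $(Y,\eta)$ with $\mathrm{stab}_*\eta=\rho$. -/

import Mathlib

open MeasureTheory Filter Topology

universe u v

/-! ### Stabilizers of Borel actions are closed -/

/-- Topological zero-one law: a Borel set that is invariant under right translation by the elements
of a dense subgroup is meagre or comeagre. -/
theorem residual_or_compl_of_dense_invariant {K : Type*} [Group K] [TopologicalSpace K]
    [IsTopologicalGroup K] [SecondCountableTopology K] [MeasurableSpace K] [BorelSpace K]
    (H : Subgroup K) (hH : Dense (H : Set K)) (A : Set K) (hA : MeasurableSet A)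
    (hinv : ∀ h ∈ H, ∀ k, k * h ∈ A ↔ k ∈ A) : A ∈ residual K ∨ Aᶜ ∈ residual K := by
  obtain ⟨U, hU, hAU⟩ := hA.residualEq_isOpen
  rcases U.eq_empty_or_nonempty with rfl | ⟨u, hu⟩
  · right
    filter_upwards [hAU] with k hk hkA
    exact (hk.mp hkA : k ∈ (∅ : Set K))
  · left
    have hopen : ∀ h : H, IsOpen ((fun k : K => k * (h : K)) ⁻¹' U) :=
      fun h => hU.preimage (continuous_mul_const _)
    obtain ⟨T, hT, hTU⟩ := TopologicalSpace.isOpen_iUnion_countable _ hopen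
    have huniv : (⋃ h : H, (fun k : K => k * (h : K)) ⁻¹' U) = Set.univ := by
      refine Set.eq_univ_of_forall fun k => ?_
      obtain ⟨h, hh, hkh⟩ := hH.exists_mem_open (hU.preimage (continuous_const_mul k))
        ⟨k⁻¹ * u, by simpa using hu⟩
      exact Set.mem_iUnion.2 ⟨⟨h, hh⟩, hkh⟩
    rw [huniv] at hTU
    have key : ∀ᶠ k in residual K, ∀ h ∈ T, (k * (h : K) ∈ A ↔ k * (h : K) ∈ U) := by
      rw [eventually_countable_ball hT]
      intro h _
      have ht := tendsto_residual_of_isOpenMap (f := fun k : K => k * (h : K))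
        (continuous_mul_const _) (isOpenMap_mul_right _)
      filter_upwards [ht.eventually hAU] with k hk
      exact iff_of_eq hk
    filter_upwards [key] with k hk
    have : k ∈ ⋃ h ∈ T, (fun k : K => k * (h : K)) ⁻¹' U := by rw [hTU]; trivial
    simp only [Set.mem_iUnion] at this
    obtain ⟨h, hhT, hkU⟩ := this
    exact (hinv h h.2 k).1 ((hk h hhT).2 hkU)

/-- Stabilizers of a Borel action of a locally compact second countable group on a countably
separated Borel space are closed. -/
theorem isClosed_stabilizer {G X : Type*} [Group G] [TopologicalSpace G] [IsTopologicalGroup G]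
    [LocallyCompactSpace G] [SecondCountableTopology G] [MeasurableSpace G] [BorelSpace G]
    [MeasurableSpace X] [MeasurableSpace.CountablySeparated X] [MulAction G X]
    [MeasurableSMul₂ G X] (x : X) : IsClosed (MulAction.stabilizer G x : Set G) := by
  set S := MulAction.stabilizer G x with hS
  set K := S.topologicalClosure with hK
  have hKc : IsClosed (K : Set G) := S.isClosed_topologicalClosure
  have : LocallyCompactSpace K := hKc.isClosedEmbedding_subtypeVal.locallyCompactSpace
  have : SecondCountableTopology K := TopologicalSpace.Subtype.secondCountableTopology (K : Set G)
  obtain ⟨e, he, hinj⟩ := MeasurableSpace.measurable_injection_nat_bool_of_countablySeparated X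
  have hf : Measurable fun k : K => e ((k : G) • x) :=
    he.comp (measurable_subtype_coe.smul_const x)
  have hdense : Dense ((S.subgroupOf K : Subgroup K) : Set K) := by
    intro k
    rw [closure_subtype]
    have himg : ((↑) '' ((S.subgroupOf K : Subgroup K) : Set K) : Set G) = S := by
      ext g
      constructor
      · rintro ⟨k, hk, rfl⟩
        exact hk
      · intro hg
        exact ⟨⟨g, S.le_topologicalClosure hg⟩, hg, rfl⟩
    rw [himg]
    exact k.2
  have h01 : ∀ n, ∃ b : Bool, ∀ᶠ k : K in residual K, e ((k : G) • x) n = b := by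
    intro n
    have hm : MeasurableSet {k : K | e ((k : G) • x) n = true} :=
      ((measurable_pi_apply n).comp hf) (measurableSet_singleton true)
    rcases residual_or_compl_of_dense_invariant (S.subgroupOf K) hdense _ hm (by
      intro h hh k
      have : (h : G) • x = x := hh
      simp [mul_smul, this]) with h | h
    · exact ⟨true, h⟩
    · refine ⟨false, ?_⟩
      filter_upwards [h] with k hk
      simpa using hk
  choose c hc using h01
  have hall : ∀ᶠ k : K in residual K, e ((k : G) • x) = c := by
    filter_upwards [eventually_countable_forall.2 hc] with k hk
    exact funext hk
  obtain ⟨k₀, hk₀⟩ := (dense_of_mem_residual hall).nonempty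
  have hfix : ∀ g : K, (g : G) • (k₀ : G) • x = (k₀ : G) • x := by
    intro g
    have ht := tendsto_residual_of_isOpenMap (f := fun k : K => g * k)
      (continuous_const_mul g) (isOpenMap_mul_left g)
    obtain ⟨k, hk1, hk2⟩ := (dense_of_mem_residual (hall.and (ht.eventually hall))).nonempty
    have h1 : (k : G) • x = (k₀ : G) • x := hinj (hk1.trans hk₀.symm)
    have h2 : ((g * k : K) : G) • x = (k₀ : G) • x := hinj (hk2.trans hk₀.symm)
    rwa [Subgroup.coe_mul, mul_smul, h1] at h2
  have hle : K ≤ S := by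
    intro g hg
    have := hfix (k₀ * ⟨g, hg⟩ * k₀⁻¹)
    rw [MulAction.mem_stabilizer_iff]
    simpa [mul_smul] using this
  have : (S : Set G) = K := le_antisymm S.le_topologicalClosure hle
  rw [this]
  exact hKc

/-! ### The space of closed subgroups -/

namespace ClosedSubgroup

variable {G : Type*} [Group G] [TopologicalSpace G]

/-- The Chabauty topology on the space `S(G)` of closed subgroups of `G`: it is generated by the
sets `{H | H ∩ C = ∅}` with `C` compact and `{H | H ∩ U ≠ ∅}` with `U` open. -/
instance chabautyTopology : TopologicalSpace (ClosedSubgroup G) :=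
  TopologicalSpace.generateFrom
    ({W | ∃ C : Set G, IsCompact C ∧ W = {H : ClosedSubgroup G | (H : Set G) ∩ C = ∅}} ∪
     {W | ∃ U : Set G, IsOpen U ∧ W = {H : ClosedSubgroup G | ((H : Set G) ∩ U).Nonempty}})

/-- `S(G)` carries the Borel sigma-algebra of the Chabauty topology. -/
instance chabautyMeasurableSpace : MeasurableSpace (ClosedSubgroup G) := borel _

instance chabautyBorelSpace : BorelSpace (ClosedSubgroup G) := ⟨rfl⟩

variable [IsTopologicalGroup G]

/-- `G` acts on `S(G)` by conjugation: `g • H = g H g⁻¹`. -/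
instance conjAction : MulAction G (ClosedSubgroup G) where
  smul g H :=
    { (H.toSubgroup.map (MulAut.conj g).toMonoidHom) with
      isClosed' := by
        have h : ((H.toSubgroup.map (MulAut.conj g).toMonoidHom : Subgroup G) : Set G) =
            (fun k => g⁻¹ * k * g) ⁻¹' H.carrier := by
          ext k
          constructor
          · rintro ⟨h, hh, rfl⟩
            simpa [mul_assoc] using hh
          · intro hk
            exact ⟨g⁻¹ * k * g, hk, by simp [mul_assoc]⟩
        change IsClosed ((H.toSubgroup.map (MulAut.conj g).toMonoidHom : Subgroup G) : Set G)
        rw [h]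
        exact H.isClosed'.preimage (by fun_prop) }
  one_smul H := toSubgroup_injective (by
    change H.toSubgroup.map (MulAut.conj (1 : G)).toMonoidHom = H.toSubgroup
    ext k
    simp)
  mul_smul g h H := toSubgroup_injective (by
    change H.toSubgroup.map (MulAut.conj (g * h)).toMonoidHom =
      (H.toSubgroup.map (MulAut.conj h).toMonoidHom).map (MulAut.conj g).toMonoidHom
    rw [Subgroup.map_map]
    congr 1
    ext k
    simp [mul_assoc])

theorem coe_smul (g : G) (H : ClosedSubgroup G) :
    ((g • H : ClosedSubgroup G) : Set G) = (fun h => g * h * g⁻¹) '' (H : Set G) := rfl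

instance continuousConstSMul : ContinuousConstSMul G (ClosedSubgroup G) where
  continuous_const_smul g := by
    refine continuous_generateFrom_iff.2 ?_
    have hc : Continuous fun h : G => g * h * g⁻¹ := by fun_prop
    rintro W (⟨C, hC, rfl⟩ | ⟨U, hU, rfl⟩)
    · refine TopologicalSpace.isOpen_generateFrom_of_mem (Or.inl
        ⟨(fun h => g⁻¹ * h * g) '' C, hC.image (by fun_prop), ?_⟩)
      ext H
      simp only [Set.mem_preimage, Set.mem_ofPred_eq, coe_smul, Set.eq_empty_iff_forall_notMem]
      constructor
      · rintro h k ⟨hk, c, hcC, rfl⟩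
        exact h c ⟨⟨_, hk, by simp [mul_assoc]⟩, hcC⟩
      · rintro h k ⟨⟨l, hl, rfl⟩, hk⟩
        exact h l ⟨hl, _, hk, by simp [mul_assoc]⟩
    · refine TopologicalSpace.isOpen_generateFrom_of_mem (Or.inr
        ⟨(fun h => g * h * g⁻¹) ⁻¹' U, hU.preimage hc, ?_⟩)
      ext H
      simp only [Set.mem_preimage, Set.mem_ofPred_eq, coe_smul]
      exact Set.image_inter_nonempty_iff

instance measurableConstSMul : MeasurableConstSMul G (ClosedSubgroup G) where
  measurable_const_smul g := (continuous_const_smul g).measurable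

end ClosedSubgroup

/-- The stabilizer map `x ↦ stab(x) = {g | g • x = x}`, with values in `S(G)`. -/
def stab (G : Type*) {X : Type*} [Group G] [TopologicalSpace G] [IsTopologicalGroup G]
    [LocallyCompactSpace G] [SecondCountableTopology G] [MeasurableSpace G] [BorelSpace G]
    [MeasurableSpace X] [StandardBorelSpace X] [MulAction G X] [MeasurableSMul₂ G X] (x : X) :
    ClosedSubgroup G where
  toSubgroup := MulAction.stabilizer G x
  isClosed' := isClosed_stabilizer x

/-! ### `G`-spaces, `G`-maps and relatively measure-preserving maps -/

/-- `G` acts on `P(X)` by translation: `(g • μ)(E) = μ(g⁻¹ E)`, the push-forward of `μ` under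
`x ↦ g • x`. -/
noncomputable instance translateSMul {G X : Type*} [Group G] [MeasurableSpace X] [MulAction G X]
    [MeasurableConstSMul G X] : SMul G (ProbabilityMeasure X) where
  smul g μ := μ.map (measurable_const_smul g).aemeasurable

/-- `ν` is a probability measure whose class of null sets is preserved by every `g ∈ G`. Together
with a Borel action on a standard Borel space this is a `G`-space. For the conjugation action on
`S(G)` it says that `ν` is a quasi-invariant random subgroup. -/
structure IsQuasiInvariant (G : Type*) {X : Type*} [Group G] [MeasurableSpace X] [MulAction G X]
    (ν : Measure X) : Prop where
  isProbabilityMeasure : IsProbabilityMeasure ν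
  null_iff : ∀ (g : G) (E : Set X), MeasurableSet E → (ν ((g • ·) ⁻¹' E) = 0 ↔ ν E = 0)

/-- `f (g x) = g f(x)` for every `g ∈ G` and almost every `x`. -/
def IsEquivariant (G : Type*) {X Z : Type*} [MeasurableSpace X] [SMul G X] [SMul G Z]
    (ν : Measure X) (f : X → Z) : Prop :=
  ∀ g : G, ∀ᵐ x ∂ν, f (g • x) = g • f x

/-- `π : (Y, η) → (X, ν)` is a `G`-map. -/
structure IsGMap (G : Type*) {X Y : Type*} [MeasurableSpace X] [MeasurableSpace Y] [SMul G X]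
    [SMul G Y] (η : Measure Y) (ν : Measure X) (π : Y → X) : Prop where
  measurable : Measurable π
  map_eq : η.map π = ν
  equivariant : IsEquivariant G η π

/-- The barycenter `∫ μ dm(μ)` of a measure `m` on `P(Z)`. -/
noncomputable def barycenter {Z : Type*} [MeasurableSpace Z] (m : Measure (ProbabilityMeasure Z)) :
    Measure Z :=
  Measure.join (m.map fun μ : ProbabilityMeasure Z => (μ : Measure Z))

/-- `D : X → P(Y)` is a disintegration of `η` over `ν` along `π : Y → X`. -/
structure IsDisintegration {X Y : Type*} [MeasurableSpace X] [MeasurableSpace Y]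
    (η : Measure Y) (ν : Measure X) (π : Y → X) (D : X → ProbabilityMeasure Y) : Prop where
  measurable : Measurable D
  fiber : ∀ᵐ x ∂ν, (D x : Measure Y) (π ⁻¹' {x}) = 1
  integral : barycenter (ν.map D) = η

/-- `π : (Y, η) → (X, ν)` is relatively measure-preserving: the (almost everywhere unique)
disintegration of `η` over `ν` along `π` is equivariant. -/
def IsRelativelyMeasurePreserving (G : Type*) {X Y : Type*} [Group G] [MeasurableSpace X]
    [MeasurableSpace Y] [MulAction G X] [MulAction G Y] [MeasurableConstSMul G Y]
    (η : Measure Y) (ν : Measure X) (π : Y → X) : Prop :=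
  ∃ D : X → ProbabilityMeasure Y, IsDisintegration η ν π D ∧ IsEquivariant G ν D

/-! Over a pair (x, H), with H distributed by φ(x), it suffices to place a random object whose
stabilizer is exactly H and whose law depends measurably on H and is carried by g to the law for
gHg⁻¹. Since H fixes x by hypothesis and normalizes itself, the triple (x, H, object) has stabilizer
H. The skew product of these laws over ν inherits quasi-invariance from ν, and its fibre measures
form an equivariant disintegration over X.

The object is a Poisson process of right cosets Hy with real labels t, recorded as the union of the
sets Hy × {t}: a closed subset of G × ℝ, on which G acts by left multiplication. Elements of H
preserve every coset. Conversely, labels are almost surely distinct, so an element mapping the set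
into itself maps some coset Hy into itself and lies in H (`isStab_cosets`). Labels range over all of
ℝ, so the intensity is infinite and the set is almost surely nonempty, even if H\G is a point.

The intensity is a measure on H\G times Lebesgue measure. Left multiplication by g maps H\G to
(gHg⁻¹)\G, so what is needed is a conjugation-equivariant family of measures; right G-invariance
plays no role. Each coset Hy receives the H-invariant measure that gives mass one to y times a fixed
neighbourhood of 1, and `transverse` is the quotient of Haar measure on G by these. The quotient is
well defined by `lintegral_mul_lintegral_cosetMeasure`, equivariant by `transverse_smul`, and
locally finite by `transverse_lt_top`, which makes unions of cosets closed. The law of a random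
closed set is determined by its void probabilities (`ext_of_void`), so equivariance and
measurability of the Poisson law reduce to those of the intensity.

Haar measures on the subgroups H are chosen separately, so measurability in H needs an argument: the
normalized coset measures are the conditional laws of a point of G given its coset, and these have a
version that is jointly measurable (`condKernel_ae_eq`). The same kernel shows that the condition H
≤ stab(x) is Borel.

For a quasi-invariant random subgroup, take X = S(G) and φ(H) the point mass at H. -/

set_option linter.unusedSectionVars false

/-! ### The Effros Borel space of closed sets -/

/-- The space of closed subsets of `E`. -/
def EffrosSpace (E : Type*) [TopologicalSpace E] := TopologicalSpace.Closeds E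

namespace EffrosSpace

open TopologicalSpace

variable {E : Type*} [TopologicalSpace E]

instance : SetLike (EffrosSpace E) E := inferInstanceAs (SetLike (Closeds E) E)

theorem isClosed (F : EffrosSpace E) : IsClosed (F : Set E) := Closeds.isClosed F

/-- The closure of a set as a point of the Effros space. -/
def ofClosure (A : Set E) : EffrosSpace E := Closeds.closure A

@[simp] theorem coe_ofClosure (A : Set E) : (ofClosure A : Set E) = closure A := rfl

/-- The closed sets that meet `U`. -/
def hit (U : Set E) : Set (EffrosSpace E) := {F | ((F : Set E) ∩ U).Nonempty}

theorem mem_hit {U : Set E} {F : EffrosSpace E} : F ∈ hit U ↔ ((F : Set E) ∩ U).Nonempty := Iff.rfl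

/-- The Effros sigma-algebra. -/
instance : MeasurableSpace (EffrosSpace E) :=
  MeasurableSpace.generateFrom {W | ∃ U : Set E, IsOpen U ∧ W = hit U}

theorem measurableSet_hit {U : Set E} (hU : IsOpen U) : MeasurableSet (hit U) :=
  MeasurableSpace.measurableSet_generateFrom ⟨U, hU, rfl⟩

theorem measurable_of_hit {Ω : Type*} [MeasurableSpace Ω] {f : Ω → EffrosSpace E}
    (h : ∀ U : Set E, IsOpen U → MeasurableSet {ω | ((f ω : Set E) ∩ U).Nonempty}) :
    Measurable f := by
  refine measurable_generateFrom ?_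
  rintro W ⟨U, hU, rfl⟩
  exact h U hU

theorem ofClosure_inter_nonempty {A U : Set E} (hU : IsOpen U) :
    ((ofClosure A : Set E) ∩ U).Nonempty ↔ (A ∩ U).Nonempty := by
  rw [coe_ofClosure]
  exact closure_inter_open_nonempty_iff hU

theorem hit_compl_inter (U V : Set E) : (hit U)ᶜ ∩ (hit V)ᶜ = (hit (U ∪ V))ᶜ := by
  rw [← Set.compl_union]
  congr 1
  ext F
  simp only [Set.mem_union, mem_hit, Set.inter_union_distrib_left, Set.union_nonempty]

/-- The complements of the hit sets form a generating pi-system. -/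
theorem generateFrom_compl_hit :
    (inferInstance : MeasurableSpace (EffrosSpace E)) =
      MeasurableSpace.generateFrom {W | ∃ U : Set E, IsOpen U ∧ W = (hit U)ᶜ} := by
  refine le_antisymm (MeasurableSpace.generateFrom_le ?_) (MeasurableSpace.generateFrom_le ?_)
  · rintro W ⟨U, hU, rfl⟩
    rw [← compl_compl (hit U)]
    have : (hit U)ᶜ ∈ {W : Set (EffrosSpace E) | ∃ U : Set E, IsOpen U ∧ W = (hit U)ᶜ} :=
      ⟨U, hU, rfl⟩
    exact MeasurableSet.compl (MeasurableSpace.measurableSet_generateFrom this)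
  · rintro W ⟨U, hU, rfl⟩
    exact (measurableSet_hit hU).compl

theorem isPiSystem_compl_hit :
    IsPiSystem {W | ∃ U : Set E, IsOpen U ∧ W = (hit U)ᶜ} := by
  rintro _ ⟨U, hU, rfl⟩ _ ⟨V, hV, rfl⟩ -
  exact ⟨U ∪ V, hU.union hV, hit_compl_inter U V⟩

/-- The law of a random closed set is determined by its void probabilities. -/
theorem ext_of_void {μ μ' : Measure (EffrosSpace E)} [IsProbabilityMeasure μ]
    [IsProbabilityMeasure μ'] (h : ∀ U : Set E, IsOpen U → μ (hit U)ᶜ = μ' (hit U)ᶜ) : μ = μ' :=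
  ext_of_generate_finite _ generateFrom_compl_hit isPiSystem_compl_hit
    (by rintro _ ⟨U, hU, rfl⟩; exact h U hU) (by simp)

variable (E) in
/-- The trace of a closed set on a countable basis. -/
def code [SecondCountableTopology E] (F : EffrosSpace E) : countableBasis E → Prop :=
  fun U => ((F : Set E) ∩ U).Nonempty

/-! ### Coding closed sets by the basic open sets they meet -/

section Code

variable [SecondCountableTopology E]

theorem exists_basis {U : Set E} (hU : IsOpen U) {x : E} (hx : x ∈ U) :
    ∃ V : countableBasis E, x ∈ (V : Set E) ∧ (V : Set E) ⊆ U := by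
  obtain ⟨V, hV, hxV, hVU⟩ := (isBasis_countableBasis E).exists_subset_of_mem_open hx hU
  exact ⟨⟨V, hV⟩, hxV, hVU⟩

theorem isOpen_basis (U : countableBasis E) : IsOpen (U : Set E) :=
  isOpen_of_mem_countableBasis U.2

theorem hit_eq_iUnion {U : Set E} (hU : IsOpen U) :
    hit U = ⋃ V : {V : countableBasis E // (V : Set E) ⊆ U}, hit (V : Set E) := by
  ext F
  simp only [Set.mem_iUnion, mem_hit]
  constructor
  · rintro ⟨x, hxF, hxU⟩
    obtain ⟨V, hxV, hVU⟩ := exists_basis hU hxU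
    exact ⟨⟨V, hVU⟩, x, hxF, hxV⟩
  · rintro ⟨V, x, hxF, hxV⟩
    exact ⟨x, hxF, V.2 hxV⟩

/-- The complement of a closed set is a union of basic open sets, so the basic sets that miss it
determine it. -/
theorem code_injective : Function.Injective (code E) := by
  intro F F' h
  have key : ∀ F F' : EffrosSpace E, code E F = code E F' → (F : Set E) ⊆ F' := by
    intro F F' h x hx
    by_contra hx'
    obtain ⟨V, hxV, hVF⟩ := exists_basis F'.isClosed.isOpen_compl hx'
    have : code E F V := ⟨x, hx, hxV⟩
    rw [h] at this
    obtain ⟨y, hy, hyV⟩ := this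
    exact hVF hyV hy
  exact SetLike.coe_injective ((key F F' h).antisymm (key F' F h.symm))

theorem measurable_code : Measurable (code E) :=
  measurable_pi_iff.2 fun U => measurableSet_setOfPred.1 (measurableSet_hit (isOpen_basis U))

theorem eq_comap_code :
    (inferInstance : MeasurableSpace (EffrosSpace E)) = MeasurableSpace.comap (code E) inferInstance := by
  refine le_antisymm (MeasurableSpace.generateFrom_le ?_) measurable_code.comap_le
  rintro W ⟨U, hU, rfl⟩
  rw [hit_eq_iUnion hU]
  refine MeasurableSet.iUnion fun V => ?_
  exact ⟨{A | A V}, measurableSet_setOfPred.2 (measurable_pi_apply _), rfl⟩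

/-- Replaces a quantifier over the points of a compact set by one over finite sets of basic open
sets, of which there are only countably many. -/
theorem exists_finset_cover {C : Set E} (hC : IsCompact C)
    (P : countableBasis E → Prop)
    (h : ∀ x ∈ C, ∃ V : countableBasis E, x ∈ (V : Set E) ∧ P V) :
    ∃ s : Finset (countableBasis E), C ⊆ (⋃ V ∈ s, (V : Set E)) ∧ ∀ V ∈ s, P V := by
  rcases C.eq_empty_or_nonempty with rfl | ⟨x₀, hx₀⟩
  · exact ⟨∅, by simp, by simp⟩
  have : Nonempty (countableBasis E) := ⟨(h x₀ hx₀).choose⟩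
  choose! W hxW hW using h
  obtain ⟨t, ht, hts⟩ := hC.elim_nhds_subcover (fun x => (W x : Set E)) fun x hx =>
    (isOpen_basis _).mem_nhds (hxW x hx)
  classical
  refine ⟨t.image W, by simpa using hts, fun V hV => ?_⟩
  obtain ⟨x, hx, rfl⟩ := Finset.mem_image.1 hV
  exact hW x (ht x hx)

/-- The conditions that characterize the codes of closed sets. -/
def IsCode (A : countableBasis E → Prop) : Prop :=
  (∀ U V : countableBasis E, (U : Set E) ⊆ V → A U → A V) ∧
  (∀ (U : countableBasis E) (s : Finset (countableBasis E)),
    IsCompact (closure (U : Set E)) → closure (U : Set E) ⊆ ⋃ V ∈ s, (V : Set E) →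
      A U → ∃ V ∈ s, A V) ∧
  (∀ U : countableBasis E, A U → ∃ V : countableBasis E,
    (IsCompact (closure (V : Set E)) ∧ closure (V : Set E) ⊆ U) ∧ A V)

theorem measurableSet_isCode : MeasurableSet {A : countableBasis E → Prop | IsCode A} := by
  have hA : ∀ U : countableBasis E, Measurable fun A : countableBasis E → Prop => A U :=
    fun U => measurable_pi_apply U
  refine measurableSet_setOfPred.2 (Measurable.and ?_ (Measurable.and ?_ ?_))
  · exact Measurable.forall fun U => Measurable.forall fun V =>
      measurable_const.imp ((hA U).imp (hA V))
  · exact Measurable.forall fun U => Measurable.forall fun s =>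
      measurable_const.imp (measurable_const.imp ((hA U).imp (Measurable.exists fun V =>
        measurable_const.and (hA V))))
  · exact Measurable.forall fun U => (hA U).imp (Measurable.exists fun V =>
      measurable_const.and (hA V))

/-- The closed set consists of the points all of whose basic neighbourhoods belong to `A`. If it
missed some `U` in `A`, a smaller `V` in `A` with compact closure inside `U` would be covered by
finitely many basic sets outside `A`, against the second condition. -/
theorem exists_code_eq {A : countableBasis E → Prop} (hA : IsCode A) :
    ∃ F : EffrosSpace E, code E F = A := by
  obtain ⟨-, h2, h3⟩ := hA
  have hcl : IsClosed {x : E | ∀ V : countableBasis E, x ∈ (V : Set E) → A V} := by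
    rw [← isOpen_compl_iff, isOpen_iff_forall_mem_open]
    intro x hx
    simp only [Set.mem_compl_iff, Set.mem_ofPred_eq, not_forall] at hx
    obtain ⟨V, hxV, hV⟩ := hx
    exact ⟨V, fun y hy hy' => hV (hy' V hy), isOpen_basis V, hxV⟩
  refine ⟨(⟨_, hcl⟩ : Closeds E), funext fun U => propext ⟨?_, fun hU => ?_⟩⟩
  · rintro ⟨x, hxF, hxU⟩
    exact hxF U hxU
  · obtain ⟨V, ⟨hVc, hVU⟩, hV⟩ := h3 U hU
    by_contra hne
    have hcov : ∀ x ∈ closure (V : Set E), ∃ W : countableBasis E, x ∈ (W : Set E) ∧ ¬ A W := by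
      intro x hx
      by_contra! hcon
      exact hne ⟨x, hcon, hVU hx⟩
    have : Nonempty (countableBasis E) := ⟨V⟩
    choose! W hxW hW using hcov
    obtain ⟨t, ht, hts⟩ := hVc.elim_nhds_subcover (fun x => (W x : Set E)) fun x hx =>
      (isOpen_basis _).mem_nhds (hxW x hx)
    classical
    obtain ⟨V', hV', hAV'⟩ := h2 V (t.image W) hVc (by simpa using hts) hV
    obtain ⟨x, hx, rfl⟩ := Finset.mem_image.1 hV'
    exact hW x (ht x hx) hAV'

variable [LocallyCompactSpace E] [T2Space E]

theorem exists_basis_compact {U : Set E} (hU : IsOpen U) {x : E} (hx : x ∈ U) :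
    ∃ V : countableBasis E, x ∈ (V : Set E) ∧ IsCompact (closure (V : Set E)) ∧
      closure (V : Set E) ⊆ U := by
  obtain ⟨K, hK, hxK, hKU⟩ := exists_compact_subset hU hx
  obtain ⟨V, hxV, hVK⟩ := exists_basis isOpen_interior hxK
  have : closure (V : Set E) ⊆ K := closure_minimal (hVK.trans interior_subset) hK.isClosed
  exact ⟨V, hxV, hK.of_isClosed_subset isClosed_closure this, this.trans hKU⟩

theorem isCode_code (F : EffrosSpace E) : IsCode (code E F) := by
  refine ⟨?_, ?_, ?_⟩
  · rintro U V hUV ⟨x, hxF, hxU⟩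
    exact ⟨x, hxF, hUV hxU⟩
  · rintro U s - hs ⟨x, hxF, hxU⟩
    have := hs (subset_closure hxU)
    simp only [Set.mem_iUnion] at this
    obtain ⟨V, hV, hxV⟩ := this
    exact ⟨V, hV, x, hxF, hxV⟩
  · rintro U ⟨x, hxF, hxU⟩
    obtain ⟨V, hxV, hVc, hVU⟩ := exists_basis_compact (isOpen_basis U) hxU
    exact ⟨V, ⟨hVc, hVU⟩, x, hxF, hxV⟩

theorem range_code : Set.range (code E) = {A | IsCode A} := by
  ext A
  constructor
  · rintro ⟨F, rfl⟩
    exact isCode_code F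
  · exact exists_code_eq

end Code

end EffrosSpace

/-! ### Standard Borel structures from Borel embeddings -/

/-- A measurable space that is carried bijectively to a Borel set of a standard Borel space is
standard Borel. -/
theorem MeasurableEmbedding.standardBorelSpace {T Z : Type*} [MeasurableSpace T]
    [MeasurableSpace Z] [StandardBorelSpace Z] {f : T → Z} (hf : MeasurableEmbedding f) :
    StandardBorelSpace T := by
  have := hf.measurableSet_range.standardBorel
  let e := hf.equivRange
  let := upgradeStandardBorel (Set.range f)
  let : TopologicalSpace T := TopologicalSpace.induced e inferInstance
  have he : Topology.IsInducing e := ⟨rfl⟩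
  let e' : T ≃ₜ Set.range f := e.toEquiv.toHomeomorphOfIsInducing he
  have hpol : PolishSpace T := e'.isClosedEmbedding.polishSpace
  have hb : BorelSpace T := ⟨by
    have h : (inferInstance : MeasurableSpace (Set.range f)) = borel _ := BorelSpace.measurable_eq
    calc _ = MeasurableSpace.comap e inferInstance := e.measurableEmbedding.comap_eq.symm
      _ = MeasurableSpace.comap e (borel _) := by rw [h]
      _ = _ := borel_comap.symm⟩
  infer_instance

theorem MeasurableEmbedding.of_comap {T Z : Type*} [mT : MeasurableSpace T] [MeasurableSpace Z]
    {f : T → Z} (hf : Function.Injective f) (h : mT = MeasurableSpace.comap f inferInstance)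
    (hr : MeasurableSet (Set.range f)) : MeasurableEmbedding f where
  injective := hf
  measurable := by rw [h]; exact comap_measurable f
  measurableSet_image' := by
    intro s hs
    rw [h] at hs
    obtain ⟨t, ht, rfl⟩ := hs
    rw [Set.image_preimage_eq_inter_range]
    exact ht.inter hr

namespace EffrosSpace

open TopologicalSpace

variable {E : Type*} [TopologicalSpace E] [SecondCountableTopology E] [LocallyCompactSpace E]
  [T2Space E]

theorem measurableEmbedding_code : MeasurableEmbedding (code E) :=
  .of_comap code_injective eq_comap_code (by rw [range_code]; exact measurableSet_isCode)

instance : StandardBorelSpace (EffrosSpace E) := measurableEmbedding_code.standardBorelSpace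

end EffrosSpace

/-! ### The translation action on closed sets -/

namespace EffrosSpace

open TopologicalSpace

variable {G E : Type*} [Group G] [TopologicalSpace E] [MulAction G E]

section Action

variable [ContinuousConstSMul G E]

/-- `G` acts on closed sets by translation. -/
instance : MulAction G (EffrosSpace E) where
  smul g F := (⟨(fun x => g⁻¹ • x) ⁻¹' (F : Set E), F.isClosed.preimage (continuous_const_smul _)⟩ :
    Closeds E)
  one_smul F := SetLike.coe_injective (by
    change (fun x => (1 : G)⁻¹ • x) ⁻¹' (F : Set E) = F
    simp)
  mul_smul g h F := SetLike.coe_injective (by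
    change (fun x => (g * h)⁻¹ • x) ⁻¹' (F : Set E) =
      (fun x => g⁻¹ • x) ⁻¹' ((fun x => h⁻¹ • x) ⁻¹' (F : Set E))
    ext x
    simp [mul_smul])

theorem mem_smul {g : G} {F : EffrosSpace E} {x : E} : x ∈ g • F ↔ g⁻¹ • x ∈ F := Iff.rfl

theorem smul_mem_smul {g : G} {F : EffrosSpace E} {x : E} : g • x ∈ g • F ↔ x ∈ F := by
  rw [mem_smul, inv_smul_smul]

theorem smul_inter_nonempty {g : G} {F : EffrosSpace E} {U : Set E} :
    (((g • F : EffrosSpace E) : Set E) ∩ U).Nonempty ↔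
      ((F : Set E) ∩ (fun x => g • x) ⁻¹' U).Nonempty := by
  constructor
  · rintro ⟨x, hx, hxU⟩
    exact ⟨g⁻¹ • x, hx, by simpa using hxU⟩
  · rintro ⟨x, hx, hxU⟩
    exact ⟨g • x, smul_mem_smul.2 hx, hxU⟩

end Action

/-- Translation of closed sets is jointly Borel. -/
instance [TopologicalSpace G] [ContinuousSMul G E] [SecondCountableTopology G]
    [SecondCountableTopology E] [MeasurableSpace G] [BorelSpace G] :
    MeasurableSMul₂ G (EffrosSpace E) where
  measurable_smul := by
    refine measurable_of_hit fun U hU => ?_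
    -- By continuity of the action the set is a countable union of rectangles, indexed by pairs of
    -- basic sets whose product is carried into `U`.
    have : {p : G × EffrosSpace E | (((p.1 • p.2 : EffrosSpace E) : Set E) ∩ U).Nonempty} =
        ⋃ q : {q : countableBasis G × countableBasis E //
          ∀ g ∈ (q.1 : Set G), ∀ x ∈ (q.2 : Set E), g • x ∈ U},
          (q.1.1 : Set G) ×ˢ hit (q.1.2 : Set E) := by
      ext ⟨g, F⟩
      simp only [Set.mem_ofPred_eq, smul_inter_nonempty, Set.mem_iUnion, Set.mem_prod, mem_hit]
      constructor
      · rintro ⟨x, hxF, hxU⟩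
        have hopen : IsOpen {p : G × E | p.1 • p.2 ∈ U} := hU.preimage continuous_smul
        obtain ⟨A, B, hA, hB, hgA, hxB, hAB⟩ := isOpen_prod_iff.1 hopen g x hxU
        obtain ⟨V, hgV, hVA⟩ := exists_basis hA hgA
        obtain ⟨W, hxW, hWB⟩ := exists_basis hB hxB
        exact ⟨⟨(V, W), fun g' hg' x' hx' => hAB (Set.mk_mem_prod (hVA hg') (hWB hx'))⟩, hgV, x, hxF, hxW⟩
      · rintro ⟨⟨⟨V, W⟩, hVW⟩, hgV, x, hxF, hxW⟩
        exact ⟨x, hxF, hVW g hgV x hxW⟩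
    have h2 := MeasurableSet.iUnion (fun q : {q : countableBasis G × countableBasis E //
          ∀ g ∈ (q.1 : Set G), ∀ x ∈ (q.2 : Set E), g • x ∈ U} =>
            ((isOpen_basis q.1.1).measurableSet.prod (measurableSet_hit (isOpen_basis q.1.2))))
    rw [← this] at h2
    exact h2

end EffrosSpace

/-! ### The space of closed subgroups is standard Borel -/

namespace ClosedSubgroup

open TopologicalSpace EffrosSpace

variable {G : Type*} [Group G] [TopologicalSpace G]

/-- A closed subgroup as a closed set. -/
def toEffros (H : ClosedSubgroup G) : EffrosSpace G := (⟨(H : Set G), H.isClosed'⟩ : Closeds G)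

@[simp] theorem coe_toEffros (H : ClosedSubgroup G) : (H.toEffros : Set G) = H := rfl

theorem toEffros_injective : Function.Injective (toEffros : ClosedSubgroup G → EffrosSpace G) :=
  fun H H' h => SetLike.coe_injective (by rw [← coe_toEffros, h, coe_toEffros])

theorem isOpen_miss {C : Set G} (hC : IsCompact C) :
    IsOpen {H : ClosedSubgroup G | (H : Set G) ∩ C = ∅} :=
  isOpen_generateFrom_of_mem (Or.inl ⟨C, hC, rfl⟩)

theorem isOpen_hit {U : Set G} (hU : IsOpen U) :
    IsOpen {H : ClosedSubgroup G | ((H : Set G) ∩ U).Nonempty} :=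
  isOpen_generateFrom_of_mem (Or.inr ⟨U, hU, rfl⟩)

theorem measurable_toEffros : Measurable (toEffros : ClosedSubgroup G → EffrosSpace G) :=
  measurable_of_hit fun _ hU => (isOpen_hit hU).measurableSet

/-- A compact set disjoint from a closed subgroup has a finite cover by basic sets that miss the
subgroup. Hence the compact-miss sets of the Chabauty topology are Borel for the Effros structure.
-/
theorem miss_eq [SecondCountableTopology G] {C : Set G} (hC : IsCompact C) :
    {H : ClosedSubgroup G | (H : Set G) ∩ C = ∅} = toEffros ⁻¹'
      ⋃ s : {s : Finset (countableBasis G) // C ⊆ ⋃ V ∈ s, (V : Set G)},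
        ⋂ V ∈ s.1, (hit (V : Set G))ᶜ := by
  ext H
  simp only [Set.mem_ofPred_eq, Set.mem_preimage, Set.mem_iUnion, Set.mem_iInter, Set.mem_compl_iff,
    mem_hit, Set.not_nonempty_iff_eq_empty, coe_toEffros]
  constructor
  · intro hHC
    obtain ⟨s, hCs, hs⟩ := exists_finset_cover hC
      (fun V => (V : Set G) ⊆ (H : Set G)ᶜ)
      fun x hx => exists_basis H.isClosed'.isOpen_compl fun hxH =>
        (Set.eq_empty_iff_forall_notMem.1 hHC) x ⟨hxH, hx⟩
    exact ⟨⟨s, hCs⟩, fun V hV => Set.disjoint_iff_inter_eq_empty.1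
      (Set.disjoint_left.2 fun x hxH hxV => hs V hV hxV hxH)⟩
  · rintro ⟨⟨s, hCs⟩, hs⟩
    refine Set.eq_empty_iff_forall_notMem.2 fun x ⟨hxH, hxC⟩ => ?_
    obtain ⟨V, hV, hxV⟩ := Set.mem_iUnion₂.1 (hCs hxC)
    exact Set.eq_empty_iff_forall_notMem.1 (hs V hV) x ⟨hxH, hxV⟩

/-- A closed set is a subgroup as soon as it contains 1 and is stable under g h⁻¹. By closedness and
continuity both can be tested on basic open sets, so the range is cut out by countably many Borel
conditions. -/
theorem range_toEffros [SecondCountableTopology G] [IsTopologicalGroup G] : Set.range (toEffros : ClosedSubgroup G → EffrosSpace G) =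
    {F | (∀ U : countableBasis G, (1 : G) ∈ (U : Set G) → F ∈ hit (U : Set G)) ∧
      ∀ U V W : countableBasis G, (∀ g ∈ (U : Set G), ∀ h ∈ (V : Set G), g * h⁻¹ ∈ (W : Set G)) →
        F ∈ hit (U : Set G) → F ∈ hit (V : Set G) → F ∈ hit (W : Set G)} := by
  ext F
  constructor
  · rintro ⟨H, rfl⟩
    refine ⟨fun U hU => ⟨1, one_mem H, hU⟩, ?_⟩
    rintro U V W hUVW ⟨g, hg, hgU⟩ ⟨h, hh, hhV⟩
    exact ⟨g * h⁻¹, div_eq_mul_inv g h ▸ div_mem (S := ClosedSubgroup G) hg hh, hUVW g hgU h hhV⟩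
  · rintro ⟨h1, h2⟩
    have one : (1 : G) ∈ F := by
      by_contra h
      obtain ⟨V, hV, hVF⟩ := exists_basis F.isClosed.isOpen_compl h
      obtain ⟨y, hy, hyV⟩ := h1 V hV
      exact hVF hyV hy
    have div : ∀ g ∈ F, ∀ h ∈ F, g * h⁻¹ ∈ F := by
      intro g hg h hh
      by_contra hgh
      obtain ⟨W, hW, hWF⟩ := exists_basis F.isClosed.isOpen_compl hgh
      have hopen : IsOpen {p : G × G | p.1 * p.2⁻¹ ∈ (W : Set G)} :=
        (isOpen_basis W).preimage (by fun_prop)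
      obtain ⟨A, B, hA, hB, hgA, hhB, hAB⟩ := isOpen_prod_iff.1 hopen g h hW
      obtain ⟨U, hgU, hUA⟩ := exists_basis hA hgA
      obtain ⟨V, hhV, hVB⟩ := exists_basis hB hhB
      obtain ⟨y, hy, hyW⟩ := h2 U V W (fun g' hg' h' hh' => hAB (Set.mk_mem_prod (hUA hg') (hVB hh')))
        ⟨g, hg, hgU⟩ ⟨h, hh, hhV⟩
      exact hWF hyW hy
    have inv : ∀ g ∈ F, g⁻¹ ∈ F := fun g hg => by simpa using div 1 one g hg
    refine ⟨⟨⟨⟨⟨(F : Set G), fun {a b} ha hb => ?_⟩, one⟩, fun {a} ha => inv a ha⟩, F.isClosed⟩, ?_⟩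
    · simpa using div a ha b⁻¹ (inv b hb)
    · exact SetLike.coe_injective rfl

/-- A countable subbasis of the Chabauty topology. -/
def countableSubbasis (G : Type*) [Group G] [TopologicalSpace G] [SecondCountableTopology G] :
    Set (Set (ClosedSubgroup G)) :=
  Set.range (fun s : {s : Finset (countableBasis G) // IsCompact (⋃ V ∈ s, closure (V : Set G))} =>
    {H : ClosedSubgroup G | (H : Set G) ∩ (⋃ V ∈ s.1, closure (V : Set G)) = ∅}) ∪
  Set.range (fun V : countableBasis G => {H : ClosedSubgroup G | ((H : Set G) ∩ V).Nonempty})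

section

variable [SecondCountableTopology G] [LocallyCompactSpace G] [T2Space G]

/-- If H misses a compact C, local compactness enlarges C to a finite union of compact closures of
basic sets that H still misses. So countably many compact sets generate the topology. -/
theorem chabautyTopology_eq :
    (chabautyTopology : TopologicalSpace (ClosedSubgroup G)) =
      TopologicalSpace.generateFrom (countableSubbasis G) := by
  refine le_antisymm (le_generateFrom ?_) (le_generateFrom ?_)
  · rintro W (⟨s, rfl⟩ | ⟨V, rfl⟩)
    · exact isOpen_miss s.2
    · exact isOpen_hit (isOpen_basis V)
  · rintro W (⟨C, hC, rfl⟩ | ⟨U, hU, rfl⟩)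
    · have : {H : ClosedSubgroup G | (H : Set G) ∩ C = ∅} =
          ⋃ s : {s : {s : Finset (countableBasis G) //
            IsCompact (⋃ V ∈ s, closure (V : Set G))} // C ⊆ ⋃ V ∈ s.1, (V : Set G)},
          {H : ClosedSubgroup G | (H : Set G) ∩ (⋃ V ∈ s.1.1, closure (V : Set G)) = ∅} := by
        ext H
        simp only [Set.mem_ofPred_eq, Set.mem_iUnion]
        constructor
        · intro hHC
          obtain ⟨s, hCs, hs⟩ := exists_finset_cover hC
            (fun V => IsCompact (closure (V : Set G)) ∧ closure (V : Set G) ⊆ (H : Set G)ᶜ)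
            fun x hx => exists_basis_compact H.isClosed'.isOpen_compl fun hxH =>
              (Set.eq_empty_iff_forall_notMem.1 hHC) x ⟨hxH, hx⟩
          refine ⟨⟨⟨s, s.isCompact_biUnion fun V hV => (hs V hV).1⟩, hCs⟩, ?_⟩
          rw [← Set.disjoint_iff_inter_eq_empty, Set.disjoint_iUnion₂_right]
          exact fun V hV => Set.disjoint_left.2 fun x hxH hxV => (hs V hV).2 hxV hxH
        · rintro ⟨s, hs⟩
          refine Set.subset_empty_iff.1 (hs ▸ Set.inter_subset_inter_right _ (s.2.trans ?_))
          exact Set.iUnion₂_mono fun V _ => subset_closure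
      rw [this]
      exact @isOpen_iUnion _ _ (TopologicalSpace.generateFrom (countableSubbasis G)) _
        fun s => isOpen_generateFrom_of_mem (Or.inl ⟨s.1, rfl⟩)
    · have : {H : ClosedSubgroup G | ((H : Set G) ∩ U).Nonempty} =
          ⋃ V : {V : countableBasis G // (V : Set G) ⊆ U},
            {H : ClosedSubgroup G | ((H : Set G) ∩ V).Nonempty} := by
        ext H
        have := Set.ext_iff.1 (hit_eq_iUnion hU) H.toEffros
        simpa [mem_hit] using this
      rw [this]
      exact @isOpen_iUnion _ _ (TopologicalSpace.generateFrom (countableSubbasis G)) _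
        fun V => isOpen_generateFrom_of_mem (Or.inr ⟨V.1, rfl⟩)

instance : SecondCountableTopology (ClosedSubgroup G) :=
  ⟨⟨countableSubbasis G, (Set.countable_range _).union (Set.countable_range _),
    chabautyTopology_eq⟩⟩

theorem eq_comap_toEffros :
    (chabautyMeasurableSpace : MeasurableSpace (ClosedSubgroup G)) =
      MeasurableSpace.comap toEffros inferInstance := by
  refine le_antisymm ?_ measurable_toEffros.comap_le
  change borel (ClosedSubgroup G) ≤ _
  rw [borel_eq_generateFrom_of_subbasis (chabautyTopology_eq (G := G))]
  refine MeasurableSpace.generateFrom_le ?_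
  rintro W (⟨s, rfl⟩ | ⟨V, rfl⟩)
  · exact ⟨_, MeasurableSet.iUnion fun t => Finset.measurableSet_biInter _ fun V _ =>
      (measurableSet_hit (isOpen_basis V)).compl, (miss_eq s.2).symm⟩
  · exact ⟨hit (V : Set G), measurableSet_hit (isOpen_basis V), rfl⟩

variable [IsTopologicalGroup G]

theorem measurableEmbedding_toEffros :
    MeasurableEmbedding (toEffros : ClosedSubgroup G → EffrosSpace G) := by
  refine .of_comap toEffros_injective eq_comap_toEffros ?_
  rw [range_toEffros]
  have hm : ∀ U : countableBasis G, Measurable fun F : EffrosSpace G => F ∈ hit (U : Set G) :=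
    fun U => measurableSet_setOfPred.1 (measurableSet_hit (isOpen_basis U))
  refine measurableSet_setOfPred.2 (Measurable.and ?_ ?_)
  · exact Measurable.forall fun U => measurable_const.imp (hm U)
  · exact Measurable.forall fun U => Measurable.forall fun V => Measurable.forall fun W =>
      measurable_const.imp ((hm U).imp ((hm V).imp (hm W)))

instance : StandardBorelSpace (ClosedSubgroup G) :=
  measurableEmbedding_toEffros.standardBorelSpace

instance [MeasurableSpace G] [BorelSpace G] : MeasurableSMul₂ G (ClosedSubgroup G) where
  measurable_smul := by
    refine measurableEmbedding_toEffros.measurable_comp_iff.1 (measurable_of_hit fun U hU => ?_)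
    have : {p : G × ClosedSubgroup G |
        (((toEffros ∘ fun p : G × ClosedSubgroup G => p.1 • p.2) p : Set G) ∩ U).Nonempty} =
        ⋃ q : {q : countableBasis G × countableBasis G //
          ∀ g ∈ (q.1 : Set G), ∀ h ∈ (q.2 : Set G), g * h * g⁻¹ ∈ U},
          (q.1.1 : Set G) ×ˢ (toEffros ⁻¹' hit (q.1.2 : Set G)) := by
      ext ⟨g, H⟩
      simp only [Function.comp, coe_toEffros, coe_smul, Set.mem_ofPred_eq, Set.mem_iUnion,
        Set.mem_prod, mem_hit, Set.mem_preimage]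
      constructor
      · rintro ⟨-, ⟨h, hH, rfl⟩, hU'⟩
        have hopen : IsOpen {p : G × G | p.1 * p.2 * p.1⁻¹ ∈ U} := hU.preimage (by fun_prop)
        obtain ⟨A, B, hA, hB, hgA, hxB, hAB⟩ := isOpen_prod_iff.1 hopen g h hU'
        obtain ⟨V, hgV, hVA⟩ := exists_basis hA hgA
        obtain ⟨W, hxW, hWB⟩ := exists_basis hB hxB
        exact ⟨⟨(V, W), fun g' hg' x' hx' => hAB (Set.mk_mem_prod (hVA hg') (hWB hx'))⟩, hgV, h, hH, hxW⟩
      · rintro ⟨⟨⟨V, W⟩, hVW⟩, hgV, h, hH, hhW⟩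
        exact ⟨_, ⟨h, hH, rfl⟩, hVW g hgV h hhW⟩
    have h2 := MeasurableSet.iUnion (fun q : {q : countableBasis G × countableBasis G //
          ∀ g ∈ (q.1 : Set G), ∀ h ∈ (q.2 : Set G), g * h * g⁻¹ ∈ U} =>
            ((isOpen_basis q.1.1).measurableSet.prod
              (measurable_toEffros (measurableSet_hit (isOpen_basis q.1.2)))))
    rw [← this] at h2
    exact h2

end

end ClosedSubgroup

/-! ### Invariant measures on the cosets of a closed subgroup -/

namespace ClosedSubgroup

open scoped ENNReal

variable {G : Type*} [Group G] [TopologicalSpace G]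

instance [LocallyCompactSpace G] (H : ClosedSubgroup G) : LocallyCompactSpace H.toSubgroup :=
  (H.isClosed'.isClosedEmbedding_subtypeVal).locallyCompactSpace

instance [SecondCountableTopology G] (H : ClosedSubgroup G) :
    SecondCountableTopology H.toSubgroup :=
  TopologicalSpace.Subtype.secondCountableTopology (H : Set G)

variable [IsTopologicalGroup G] [T2Space G] [LocallyCompactSpace G]

variable (G) in
theorem exists_unitNhd : ∃ V : Set G, IsOpen V ∧ 1 ∈ V ∧ IsCompact (closure V) := by
  obtain ⟨K, hK, h1⟩ := exists_compact_mem_nhds (1 : G)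
  exact ⟨interior K, isOpen_interior, mem_interior_iff_mem_nhds.2 h1,
    hK.of_isClosed_subset isClosed_closure (closure_minimal interior_subset hK.isClosed)⟩

variable (G) in
/-- A relatively compact open neighbourhood of the identity. -/
noncomputable def unitNhd : Set G := (exists_unitNhd G).choose

theorem isOpen_unitNhd : IsOpen (unitNhd G) := (exists_unitNhd G).choose_spec.1

theorem one_mem_unitNhd : (1 : G) ∈ unitNhd G := (exists_unitNhd G).choose_spec.2.1

theorem isCompact_closure_unitNhd : IsCompact (closure (unitNhd G)) :=
  (exists_unitNhd G).choose_spec.2.2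

/-- The elements of `H` that right multiplication by `y` moves into `y * unitNhd G`. -/
def ball (H : ClosedSubgroup G) (y : G) : Set H.toSubgroup :=
  {h | y⁻¹ * (h : G) * y ∈ unitNhd G}

theorem isOpen_ball (H : ClosedSubgroup G) (y : G) : IsOpen (H.ball y) :=
  isOpen_unitNhd.preimage (by fun_prop)

theorem one_mem_ball (H : ClosedSubgroup G) (y : G) : 1 ∈ H.ball y := by
  simp [ball, one_mem_unitNhd]

variable [SecondCountableTopology G] [MeasurableSpace G] [BorelSpace G]

theorem measurable_coe_mul (H : ClosedSubgroup G) (y : G) :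
    Measurable fun h : H.toSubgroup => (h : G) * y :=
  (measurable_subtype_coe (p := fun g => g ∈ H.toSubgroup)).mul_const y

section AnyHaar

variable (H : ClosedSubgroup G) (μ : Measure H.toSubgroup) [μ.IsHaarMeasure]

theorem measure_ball_ne_zero (y : G) : μ (H.ball y) ≠ 0 :=
  (H.isOpen_ball y).measure_ne_zero μ ⟨1, H.one_mem_ball y⟩

/-- H is closed in G, so its intersection with the compact set y · closure(`unitNhd G`) · y⁻¹ is
compact in H. -/
theorem measure_ball_ne_top (y : G) : μ (H.ball y) ≠ ∞ := by
  have hc : IsCompact ((fun h : H.toSubgroup => y⁻¹ * (h : G) * y) ⁻¹' closure (unitNhd G)) := by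
    have h1 : IsCompact ((fun g : G => y * g * y⁻¹) '' closure (unitNhd G)) :=
      isCompact_closure_unitNhd.image (by fun_prop)
    have h2 := (H.isClosed'.isClosedEmbedding_subtypeVal).isCompact_preimage h1
    convert! h2 using 1
    ext h
    simp only [Set.mem_preimage, Set.mem_image]
    constructor
    · intro hh
      exact ⟨_, hh, by simp [mul_assoc]⟩
    · rintro ⟨g, hg, hgh⟩
      have : y⁻¹ * (h : G) * y = g := by
        rw [show (h : G) = y * g * y⁻¹ from hgh.symm]
        simp [mul_assoc]
      rwa [this]
  have hsub : H.ball y ⊆ (fun h : H.toSubgroup => y⁻¹ * (h : G) * y) ⁻¹' closure (unitNhd G) :=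
    fun h hh => subset_closure (show y⁻¹ * (h : G) * y ∈ unitNhd G from hh)
  exact ((measure_mono hsub).trans_lt hc.measure_lt_top).ne

theorem exists_eq_smul_haar : ∃ c : ℝ≥0∞, c ≠ 0 ∧ c ≠ ∞ ∧ μ = c • Measure.haar := by
  have h := Measure.isMulLeftInvariant_eq_smul μ Measure.haar
  refine ⟨(μ.haarScalarFactor Measure.haar : ℝ≥0∞), fun h0 => ?_, ENNReal.coe_ne_top, h⟩
  refine NeZero.ne μ ?_
  rw [h, ENNReal.coe_eq_zero.1 h0, zero_smul]

end AnyHaar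

/-- The normalizing factor of `cosetMeasure`. -/
noncomputable def scale (H : ClosedSubgroup G) (y : G) : ℝ≥0∞ := Measure.haar (H.ball y)

/-- The left `H`-invariant measure on the coset `H y` that gives mass one to `y * unitNhd G`. -/
noncomputable def cosetMeasure (H : ClosedSubgroup G) (y : G) : Measure G :=
  (H.scale y)⁻¹ • Measure.haar.map fun h : H.toSubgroup => (h : G) * y

theorem scale_ne_zero (H : ClosedSubgroup G) (y : G) : H.scale y ≠ 0 :=
  H.measure_ball_ne_zero _ y

theorem scale_ne_top (H : ClosedSubgroup G) (y : G) : H.scale y ≠ ∞ :=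
  H.measure_ball_ne_top _ y

/-- Haar measures on H are proportional and the normalization cancels the factor, so the chosen Haar
measure is immaterial. -/
theorem cosetMeasure_eq (H : ClosedSubgroup G) (μ : Measure H.toSubgroup) [μ.IsHaarMeasure]
    (y : G) :
    H.cosetMeasure y = (μ (H.ball y))⁻¹ • μ.map fun h : H.toSubgroup => (h : G) * y := by
  obtain ⟨c, hc0, hct, hc⟩ := H.exists_eq_smul_haar μ
  rw [hc, Measure.map_smul, Measure.smul_apply, smul_smul, cosetMeasure, scale, smul_eq_mul,
    ENNReal.mul_inv (Or.inl hc0) (Or.inl hct), mul_right_comm, ENNReal.inv_mul_cancel hc0 hct,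
    one_mul]

/-- Left invariance turns conjugation by h into right translation by h, the only place where the
modular function of H can enter. -/
theorem ball_mul (H : ClosedSubgroup G) (h : H.toSubgroup) (y : G) :
    Measure.haar (H.ball ((h : G) * y)) = (Measure.haar.map (· * h)) (H.ball y) := by
  rw [Measure.map_apply (measurable_mul_const h) (H.isOpen_ball y).measurableSet,
    ← measure_preimage_mul Measure.haar h (H.ball ((h : G) * y))]
  congr 1
  ext k
  simp [ball, mul_assoc]

/-- A right translate of Haar measure is again a Haar measure, and `cosetMeasure` does not see which
one is used. The measure thus depends only on the coset. -/
theorem cosetMeasure_mul (H : ClosedSubgroup G) (h : H.toSubgroup) (y : G) :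
    H.cosetMeasure ((h : G) * y) = H.cosetMeasure y := by
  rw [H.cosetMeasure_eq (Measure.haar.map (· * h)) y, ← H.ball_mul,
    Measure.map_map (H.measurable_coe_mul y) (measurable_mul_const h), cosetMeasure, scale]
  congr 2
  ext k
  simp [mul_assoc]

/-- Moving the base point by h multiplies every scale by one constant, the value at h of the modular
character up to convention; moving it by h⁻¹ divides by the same constant. -/
theorem scale_mul_scale (H : ClosedSubgroup G) (h : H.toSubgroup) (y : G) :
    H.scale ((h : G) * y) * H.scale ((h⁻¹ : H.toSubgroup) * y) = H.scale y * H.scale y := by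
  obtain ⟨c, hc0, hct, hc⟩ := H.exists_eq_smul_haar (Measure.haar.map (· * h))
  have key : ∀ z, H.scale ((h : G) * z) = c * H.scale z := by
    intro z
    rw [scale, H.ball_mul, hc]
    rfl
  have h2 := key ((h⁻¹ : H.toSubgroup) * y)
  rw [show (h : G) * (((h⁻¹ : H.toSubgroup) : G) * y) = y by simp] at h2
  conv_rhs => rw [h2]
  rw [key, h2]
  ring

/-- Conjugation by `g` as an isomorphism `H ≃ g H g⁻¹`. -/
def conjEquiv (g : G) (H : ClosedSubgroup G) : H.toSubgroup ≃* (g • H).toSubgroup :=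
  (MulAut.conj g).subgroupMap H.toSubgroup

theorem coe_conjEquiv (g : G) (H : ClosedSubgroup G) (h : H.toSubgroup) :
    ((conjEquiv g H h : (g • H).toSubgroup) : G) = g * h * g⁻¹ := rfl

theorem continuous_conjEquiv (g : G) (H : ClosedSubgroup G) : Continuous (conjEquiv g H) :=
  Continuous.subtype_mk (by fun_prop : Continuous fun h : H.toSubgroup => g * (h : G) * g⁻¹) _

theorem continuous_conjEquiv_symm (g : G) (H : ClosedSubgroup G) :
    Continuous (conjEquiv g H).symm := by
  refine continuous_induced_rng.2 ?_
  have : (Subtype.val ∘ (conjEquiv g H).symm) = fun k : (g • H).toSubgroup => g⁻¹ * (k : G) * g := by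
    ext k
    obtain ⟨h, rfl⟩ := (conjEquiv g H).surjective k
    simp [coe_conjEquiv, mul_assoc]
  rw [this]
  fun_prop

/-- Conjugation by g carries a Haar measure of H to one of gHg⁻¹ and the normalizing ball at y to
the ball at gy, so the normalized measures correspond. -/
theorem cosetMeasure_smul (g : G) (H : ClosedSubgroup G) (y : G) :
    (g • H).cosetMeasure (g * y) = (H.cosetMeasure y).map (g * ·) := by
  have hc := continuous_conjEquiv g H
  have hm := hc.measurable
  have := MulEquiv.isHaarMeasure_map (Measure.haar (G := H.toSubgroup)) (conjEquiv g H) hc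
    (continuous_conjEquiv_symm g H)
  rw [(g • H).cosetMeasure_eq (Measure.haar.map (conjEquiv g H)),
    Measure.map_apply hm ((g • H).isOpen_ball _).measurableSet,
    Measure.map_map ((g • H).measurable_coe_mul _) hm, cosetMeasure, Measure.map_smul,
    Measure.map_map (measurable_const_mul g) (H.measurable_coe_mul y), scale]
  have h1 : conjEquiv g H ⁻¹' (g • H).ball (g * y) = H.ball y := by
    ext h
    simp [ball, coe_conjEquiv, mul_assoc]
  have h2 : (fun h : (g • H).toSubgroup => (h : G) * (g * y)) ∘ conjEquiv g H =
      (g * ·) ∘ fun h : H.toSubgroup => (h : G) * y := by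
    ext h
    simp [coe_conjEquiv, mul_assoc]
  rw [h1, h2]

theorem lintegral_cosetMeasure (H : ClosedSubgroup G) (y : G) {f : G → ℝ≥0∞} (hf : Measurable f) :
    ∫⁻ k, f k ∂H.cosetMeasure y =
      (H.scale y)⁻¹ * ∫⁻ h : H.toSubgroup, f ((h : G) * y) ∂Measure.haar := by
  rw [cosetMeasure, lintegral_smul_measure, lintegral_map hf (H.measurable_coe_mul y), smul_eq_mul]

theorem cosetMeasure_unitNhd (H : ClosedSubgroup G) (y : G) :
    H.cosetMeasure y {k | y⁻¹ * k ∈ unitNhd G} = 1 := by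
  have hm : MeasurableSet {k | y⁻¹ * k ∈ unitNhd G} :=
    (isOpen_unitNhd.preimage (by fun_prop : Continuous fun k => y⁻¹ * k)).measurableSet
  have h1 : (fun h : H.toSubgroup => (h : G) * y) ⁻¹' {k | y⁻¹ * k ∈ unitNhd G} = H.ball y := by
    ext h
    simp [ball, mul_assoc]
  rw [cosetMeasure, Measure.smul_apply, Measure.map_apply (H.measurable_coe_mul y) hm, h1,
    smul_eq_mul]
  exact ENNReal.inv_mul_cancel (H.scale_ne_zero y) (H.scale_ne_top y)

theorem measurable_coe_mul_uncurry (H : ClosedSubgroup G) :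
    Measurable fun p : G × H.toSubgroup => (p.2 : G) * p.1 :=
  ((measurable_subtype_coe (p := fun g => g ∈ H.toSubgroup)).comp measurable_snd).mul measurable_fst

theorem measurable_scale (H : ClosedSubgroup G) : Measurable H.scale := by
  have : MeasurableSet {p : G × H.toSubgroup | p.1⁻¹ * (p.2 : G) * p.1 ∈ unitNhd G} :=
    (isOpen_unitNhd.preimage (by fun_prop)).measurableSet
  exact measurable_measure_prodMk_left this

theorem measurable_lintegral_cosetMeasure (H : ClosedSubgroup G) {f : G → ℝ≥0∞}
    (hf : Measurable f) : Measurable fun y => ∫⁻ k, f k ∂H.cosetMeasure y := by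
  simp_rw [H.lintegral_cosetMeasure _ hf]
  refine H.measurable_scale.inv.mul ?_
  exact Measurable.lintegral_prod_right' (f := fun p : G × H.toSubgroup => f ((p.2 : G) * p.1))
    (hf.comp H.measurable_coe_mul_uncurry)

/-- Inversion in H produces a modular factor. `measure_mul_lintegral_eq`, applied to the ball at y,
expresses it through scales, and `scale_mul_scale` converts the scale at hy into the inverse scale
at h⁻¹y. -/
theorem lintegral_inv_scale (H : ClosedSubgroup G) (y : G) {a : G → ℝ≥0∞} (ha : Measurable a) :
    ∫⁻ h : H.toSubgroup, a ((h⁻¹ : H.toSubgroup) * y) * (H.scale ((h⁻¹ : H.toSubgroup) * y))⁻¹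
      ∂Measure.haar = (H.scale y)⁻¹ * ∫⁻ h : H.toSubgroup, a ((h : G) * y) ∂Measure.haar := by
  set c := H.scale y with hc
  have hc0 : c ≠ 0 := H.scale_ne_zero y
  have hct : c ≠ ∞ := H.scale_ne_top y
  have key := measure_mul_lintegral_eq Measure.haar Measure.haar (H.isOpen_ball y).measurableSet
    (fun h : H.toSubgroup => a ((h : G) * y)) (ha.comp (H.measurable_coe_mul y))
  have hx : ∀ x : H.toSubgroup, Measure.haar ((fun z => z * x) ⁻¹' H.ball y) =
      H.scale ((x : G) * y) := by
    intro x
    rw [scale, H.ball_mul, Measure.map_apply (measurable_mul_const x) (H.isOpen_ball y).measurableSet]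
  simp_rw [hx] at key
  have hpt : ∀ h : H.toSubgroup,
      a ((h⁻¹ : H.toSubgroup) * y) * (H.scale ((h⁻¹ : H.toSubgroup) * y))⁻¹ =
        (c⁻¹ * c⁻¹) * (H.scale ((h : G) * y) * a ((h⁻¹ : H.toSubgroup) * y)) := by
    intro h
    have h1 := H.scale_mul_scale h y
    rw [← hc] at h1
    have h2 := H.scale_ne_zero ((h⁻¹ : H.toSubgroup) * y)
    have h3 := H.scale_ne_top ((h⁻¹ : H.toSubgroup) * y)
    have h4 : (H.scale ((h⁻¹ : H.toSubgroup) * y))⁻¹ = (c⁻¹ * c⁻¹) * H.scale ((h : G) * y) := by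
      rw [← ENNReal.mul_inv (Or.inl hc0) (Or.inl hct), ← h1, ENNReal.mul_inv (Or.inr h3) (Or.inr h2),
        mul_right_comm, ENNReal.inv_mul_cancel (H.scale_ne_zero _) (H.scale_ne_top _), one_mul]
    rw [h4]
    ring
  have hinv : Measurable fun h : H.toSubgroup => ((h⁻¹ : H.toSubgroup) : G) * y :=
    (H.measurable_coe_mul y).comp measurable_inv
  simp_rw [hpt]
  have hm : Measurable fun h : H.toSubgroup =>
      H.scale ((h : G) * y) * a ((h⁻¹ : H.toSubgroup) * y) :=
    (H.measurable_scale.comp (H.measurable_coe_mul y)).mul (ha.comp hinv)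
  rw [lintegral_const_mul _ hm, ← key, mul_assoc, ← mul_assoc c⁻¹ (Measure.haar _), ← scale, ← hc,
    ENNReal.inv_mul_cancel hc0 hct, one_mul]

/-- The equivalence relation of lying in the same right coset of `H`, equipped with the coset
measures, is measure preserving for Haar measure. -/
theorem lintegral_mul_lintegral_cosetMeasure (H : ClosedSubgroup G) {F a b : G → ℝ≥0∞}
    (hF : Measurable F) (ha : Measurable a) (hb : Measurable b)
    (hinv : ∀ h ∈ H, ∀ y, F (h * y) = F y) :
    ∫⁻ y, F y * a y * ∫⁻ k, b k ∂H.cosetMeasure y ∂Measure.haar =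
      ∫⁻ y, F y * b y * ∫⁻ k, a k ∂H.cosetMeasure y ∂Measure.haar := by
  have hcoe := H.measurable_coe_mul_uncurry
  have hcoe' : Measurable fun p : G × H.toSubgroup => ((p.2⁻¹ : H.toSubgroup) : G) * p.1 :=
    hcoe.comp (measurable_fst.prodMk measurable_snd.inv)
  have hF1 : Measurable fun p : G × H.toSubgroup => F p.1 := hF.comp measurable_fst
  calc ∫⁻ y, F y * a y * ∫⁻ k, b k ∂H.cosetMeasure y ∂Measure.haar
      = ∫⁻ y, ∫⁻ h : H.toSubgroup, F y * a y * (H.scale y)⁻¹ * b ((h : G) * y)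
          ∂Measure.haar ∂Measure.haar := by
        refine lintegral_congr fun y => ?_
        have hm : Measurable fun h : H.toSubgroup => b ((h : G) * y) :=
          hb.comp (H.measurable_coe_mul y)
        rw [H.lintegral_cosetMeasure y hb, ← mul_assoc, lintegral_const_mul _ hm]
    _ = ∫⁻ h : H.toSubgroup, ∫⁻ y, F y * a y * (H.scale y)⁻¹ * b ((h : G) * y)
          ∂Measure.haar ∂Measure.haar :=
        lintegral_lintegral_swap (((hF1.mul (ha.comp measurable_fst)).mul
          (H.measurable_scale.comp measurable_fst).inv).mul (hb.comp hcoe)).aemeasurable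
    _ = ∫⁻ h : H.toSubgroup, ∫⁻ y, F y * b y * (a ((h⁻¹ : H.toSubgroup) * y) *
          (H.scale ((h⁻¹ : H.toSubgroup) * y))⁻¹) ∂Measure.haar ∂Measure.haar := by
        refine lintegral_congr fun h => ?_
        -- Left invariance of Haar measure on G under h⁻¹, with `F` unchanged because it is
        -- H-invariant.
        rw [← lintegral_mul_left_eq_self _ ((h⁻¹ : H.toSubgroup) : G)]
        refine lintegral_congr fun y => ?_
        rw [hinv _ (h⁻¹).2, show (h : G) * (((h⁻¹ : H.toSubgroup) : G) * y) = y by simp]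
        ring
    _ = ∫⁻ y, ∫⁻ h : H.toSubgroup, F y * b y * (a ((h⁻¹ : H.toSubgroup) * y) *
          (H.scale ((h⁻¹ : H.toSubgroup) * y))⁻¹) ∂Measure.haar ∂Measure.haar :=
        (lintegral_lintegral_swap ((hF1.mul (hb.comp measurable_fst)).mul ((ha.comp hcoe').mul
          (H.measurable_scale.comp hcoe').inv)).aemeasurable).symm
    _ = ∫⁻ y, F y * b y * ∫⁻ k, a k ∂H.cosetMeasure y ∂Measure.haar := by
        refine lintegral_congr fun y => ?_
        have hi : Measurable fun h : H.toSubgroup => ((h⁻¹ : H.toSubgroup) : G) * y :=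
          (H.measurable_coe_mul y).comp measurable_inv
        have hm : Measurable fun h : H.toSubgroup => a ((h⁻¹ : H.toSubgroup) * y) *
            (H.scale ((h⁻¹ : H.toSubgroup) * y))⁻¹ :=
          (ha.comp hi).mul (H.measurable_scale.comp hi).inv
        rw [lintegral_const_mul _ hm, H.lintegral_inv_scale y ha, H.lintegral_cosetMeasure y ha]

end ClosedSubgroup

/-! ### Points as closed sets -/

namespace EffrosSpace

open TopologicalSpace

variable {E : Type*} [TopologicalSpace E] [SecondCountableTopology E] [T2Space E]

/-- A point as a closed set. -/
def ofPoint (x : E) : EffrosSpace E := ofClosure {x}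

@[simp] theorem coe_ofPoint (x : E) : (ofPoint x : Set E) = {x} := by
  rw [ofPoint, coe_ofClosure, closure_singleton]

theorem preimage_ofPoint_hit (U : Set E) : ofPoint ⁻¹' hit U = U := by
  ext x
  simp [mem_hit]

/-- In a Hausdorff space a nonempty closed set is a single point exactly when no two disjoint basic
sets both meet it; these are countably many conditions. -/
theorem range_ofPoint : Set.range (ofPoint : E → EffrosSpace E) =
    {F | F ∈ hit Set.univ ∧ ∀ U V : countableBasis E, Disjoint (U : Set E) V →
      F ∈ hit (U : Set E) → F ∉ hit (V : Set E)} := by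
  ext F
  constructor
  · rintro ⟨x, rfl⟩
    refine ⟨⟨x, by simp⟩, fun U V hUV hU hV => ?_⟩
    simp only [mem_hit, coe_ofPoint, Set.singleton_inter_nonempty] at hU hV
    exact Set.disjoint_left.1 hUV hU hV
  · rintro ⟨⟨x, hx, -⟩, h⟩
    refine ⟨x, SetLike.coe_injective ?_⟩
    rw [coe_ofPoint]
    refine Set.Subset.antisymm (by simpa using hx) fun y hy => ?_
    by_contra hxy
    obtain ⟨A, B, hA, hB, hyA, hxB, hAB⟩ := t2_separation hxy
    obtain ⟨U, hyU, hUA⟩ := exists_basis hA hyA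
    obtain ⟨V, hxV, hVB⟩ := exists_basis hB hxB
    exact h U V (hAB.mono hUA hVB) ⟨y, hy, hyU⟩ ⟨x, hx, hxV⟩

/-- A locally compact second countable Hausdorff space is standard Borel. -/
theorem standardBorelSpace_of_locallyCompact (E : Type*) [TopologicalSpace E]
    [SecondCountableTopology E] [T2Space E] [LocallyCompactSpace E] [MeasurableSpace E]
    [BorelSpace E] : StandardBorelSpace E := by
  refine (MeasurableEmbedding.of_comap (f := (ofPoint : E → EffrosSpace E)) ?_ ?_ ?_).standardBorelSpace
  · intro x y h
    have := congrArg (fun F : EffrosSpace E => (F : Set E)) h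
    simpa using this
  · refine le_antisymm ((BorelSpace.measurable_eq (α := E)).trans_le
      (MeasurableSpace.generateFrom_le fun U hU =>
        ⟨hit U, measurableSet_hit hU, preimage_ofPoint_hit U⟩)) ?_
    refine Measurable.comap_le (measurable_generateFrom ?_)
    rintro W ⟨U, hU, rfl⟩
    rw [preimage_ofPoint_hit]
    exact hU.measurableSet
  · rw [range_ofPoint]
    have hm : ∀ {U : Set E}, IsOpen U → Measurable fun F : EffrosSpace E => F ∈ hit U :=
      fun hU => measurableSet_setOfPred.1 (measurableSet_hit hU)
    exact measurableSet_setOfPred.2 (Measurable.and (hm isOpen_univ)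
      (Measurable.forall fun U => Measurable.forall fun V => measurable_const.imp
        ((hm (isOpen_basis U)).imp (hm (isOpen_basis V)).not)))

end EffrosSpace

namespace ClosedSubgroup

open scoped ENNReal
open TopologicalSpace EffrosSpace

variable {G : Type*} [Group G] [TopologicalSpace G] [IsTopologicalGroup G] [T2Space G]
  [LocallyCompactSpace G] [SecondCountableTopology G] [MeasurableSpace G] [BorelSpace G]

/-! ### The transverse measure -/

theorem cosetMeasure_mul_of_mem (H : ClosedSubgroup G) {h : G} (hh : h ∈ H) (y : G) :
    H.cosetMeasure (h * y) = H.cosetMeasure y :=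
  H.cosetMeasure_mul ⟨h, hh⟩ y

/-- A weight on `G` that is integrable for Haar measure and for all coset measures. -/
theorem exists_weight : ∃ w : G → ℝ≥0∞, Measurable w ∧ (∀ y, w y ≠ 0) ∧ (∀ y, w y ≠ ∞) ∧
    ∫⁻ y, w y ∂Measure.haar ≠ ∞ ∧
    ∀ (H : ClosedSubgroup G) (y : G), ∫⁻ k, w k ∂H.cosetMeasure y ≤ 1 := by
  have hopen : IsOpen {p : G × G | p.1⁻¹ * p.2 ∈ unitNhd G} := isOpen_unitNhd.preimage (by fun_prop)
  obtain ⟨A, B, hA, hB, h1A, h1B, hAB⟩ := isOpen_prod_iff.1 hopen 1 1 (by simp [one_mem_unitNhd])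
  -- `V` satisfies V⁻¹V ⊆ `unitNhd G`. Its translates `S n` by a dense sequence cover G, and the
  -- weight is a summable combination of their indicators.
  set V := A ∩ B ∩ unitNhd G with hV
  have hVo : IsOpen V := (hA.inter hB).inter isOpen_unitNhd
  have hV1 : (1 : G) ∈ V := ⟨⟨h1A, h1B⟩, one_mem_unitNhd⟩
  have hVV : ∀ x ∈ V, ∀ y ∈ V, x⁻¹ * y ∈ unitNhd G := fun x hx y hy =>
    hAB (Set.mk_mem_prod hx.1.1 hy.1.2)
  set x := denseSeq G with hx
  set S : ℕ → Set G := fun n => (fun y => (x n)⁻¹ * y) ⁻¹' V with hS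
  have hSo : ∀ n, IsOpen (S n) := fun n => hVo.preimage (by fun_prop)
  have hcov : ∀ y, ∃ n, y ∈ S n := by
    intro y
    exact (denseRange_denseSeq G).exists_mem_open
      (hVo.preimage (by fun_prop : Continuous fun z : G => z⁻¹ * y)) ⟨y, by simpa using hV1⟩
  obtain ⟨ε, hε0, hε1⟩ := ENNReal.exists_pos_sum_of_countable' one_ne_zero ℕ
  have hmeas : ∀ n, Measurable fun y => ε n * (S n).indicator (1 : G → ℝ≥0∞) y := fun n =>
    (measurable_one.indicator (hSo n).measurableSet).const_mul _
  have hint : ∀ μ : Measure G, ∫⁻ y, ∑' n, ε n * (S n).indicator (1 : G → ℝ≥0∞) y ∂μ =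
      ∑' n, ε n * μ (S n) := by
    intro μ
    rw [lintegral_tsum fun n => (hmeas n).aemeasurable]
    refine tsum_congr fun n => ?_
    rw [lintegral_const_mul _ (measurable_one.indicator (hSo n).measurableSet),
      lintegral_indicator_one (hSo n).measurableSet]
  refine ⟨fun y => ∑' n, ε n * (S n).indicator (1 : G → ℝ≥0∞) y, Measurable.tsum hmeas,
    fun y => ?_, fun y => ?_, ?_, fun H y => ?_⟩
  · obtain ⟨n, hn⟩ := hcov y
    refine (lt_of_lt_of_le ?_ (ENNReal.le_tsum n)).ne'
    simpa [hn] using hε0 n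
  · refine ((ENNReal.tsum_le_tsum fun n => ?_).trans_lt (hε1.trans ENNReal.one_lt_top)).ne
    by_cases hn : y ∈ S n <;> simp [hn]
  · rw [hint]
    have hSn : ∀ n, Measure.haar (S n) = Measure.haar V := fun n =>
      measure_preimage_mul Measure.haar _ _
    simp_rw [hSn, ENNReal.tsum_mul_right]
    refine ENNReal.mul_ne_top (hε1.trans ENNReal.one_lt_top).ne ?_
    exact ((measure_mono (Set.inter_subset_right.trans subset_closure)).trans_lt
      isCompact_closure_unitNhd.measure_lt_top).ne
  · rw [hint]
    refine (ENNReal.tsum_le_tsum fun n => ?_).trans hε1.le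
    refine mul_le_of_le_one_right' ?_
    -- If the coset meets `S n` in a point z, then `S n` lies in z · `unitNhd G`, which has mass
    -- one; otherwise `S n` has mass zero.
    by_cases hne : ∃ h ∈ H, h * y ∈ S n
    · obtain ⟨h, hh, hy⟩ := hne
      rw [← H.cosetMeasure_mul_of_mem hh, ← H.cosetMeasure_unitNhd (h * y)]
      refine measure_mono fun k hk => ?_
      have := hVV _ hy _ hk
      simpa [mul_assoc] using this
    · have : (fun h : H.toSubgroup => (h : G) * y) ⁻¹' S n = ∅ :=
        Set.eq_empty_iff_forall_notMem.2 fun h hh => hne ⟨h, h.2, hh⟩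
      rw [cosetMeasure, Measure.smul_apply, Measure.map_apply (H.measurable_coe_mul y)
        (hSo n).measurableSet, this]
      simp

variable (G) in
/-- A weight on `G` that is integrable for Haar measure and for all coset measures. -/
noncomputable def weight : G → ℝ≥0∞ := (exists_weight (G := G)).choose

theorem measurable_weight : Measurable (weight G) := (exists_weight (G := G)).choose_spec.1

theorem weight_ne_zero (y : G) : weight G y ≠ 0 := (exists_weight (G := G)).choose_spec.2.1 y

theorem weight_ne_top (y : G) : weight G y ≠ ∞ := (exists_weight (G := G)).choose_spec.2.2.1 y

theorem lintegral_weight_haar_ne_top : ∫⁻ y, weight G y ∂Measure.haar ≠ ∞ :=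
  (exists_weight (G := G)).choose_spec.2.2.2.1

theorem lintegral_weight_le_one (H : ClosedSubgroup G) (y : G) :
    ∫⁻ k, weight G k ∂H.cosetMeasure y ≤ 1 :=
  (exists_weight (G := G)).choose_spec.2.2.2.2 H y

theorem lintegral_weight_ne_top (H : ClosedSubgroup G) (y : G) :
    ∫⁻ k, weight G k ∂H.cosetMeasure y ≠ ∞ :=
  ((H.lintegral_weight_le_one y).trans_lt ENNReal.one_lt_top).ne

theorem lintegral_cosetMeasure_ne_zero (H : ClosedSubgroup G) (y : G) {w : G → ℝ≥0∞}
    (hw : Measurable w) (hw0 : ∀ y, w y ≠ 0) : ∫⁻ k, w k ∂H.cosetMeasure y ≠ 0 := by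
  intro h0
  rw [lintegral_eq_zero_iff hw] at h0
  have : H.cosetMeasure y = 0 := by
    rw [← Measure.measure_univ_eq_zero]
    refine measure_mono_null (fun k _ => ?_) h0
    exact hw0 k
  have h1 := H.cosetMeasure_unitNhd y
  simp [this] at h1

/-- The density of the transverse measure. -/
noncomputable def transverseDensity (H : ClosedSubgroup G) (w : G → ℝ≥0∞) (y : G) : ℝ≥0∞ :=
  w y * (∫⁻ k, w k ∂H.cosetMeasure y)⁻¹

theorem measurable_transverseDensity (H : ClosedSubgroup G) {w : G → ℝ≥0∞} (hw : Measurable w) :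
    Measurable (H.transverseDensity w) :=
  hw.mul (H.measurable_lintegral_cosetMeasure hw).inv

/-- On left `H`-invariant sets the transverse measure does not depend on the weight. -/
theorem setLIntegral_transverseDensity_congr (H : ClosedSubgroup G) {w w' : G → ℝ≥0∞}
    (hw : Measurable w) (hw' : Measurable w')
    (h0 : ∀ y, ∫⁻ k, w k ∂H.cosetMeasure y ≠ 0) (ht : ∀ y, ∫⁻ k, w k ∂H.cosetMeasure y ≠ ∞)
    (h0' : ∀ y, ∫⁻ k, w' k ∂H.cosetMeasure y ≠ 0) (ht' : ∀ y, ∫⁻ k, w' k ∂H.cosetMeasure y ≠ ∞)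
    {A : Set G} (hA : MeasurableSet A) (hinv : ∀ h ∈ H, ∀ y, h * y ∈ A ↔ y ∈ A) :
    ∫⁻ y in A, H.transverseDensity w y ∂Measure.haar =
      ∫⁻ y in A, H.transverseDensity w' y ∂Measure.haar := by
  have hm := H.measurable_lintegral_cosetMeasure hw
  have hm' := H.measurable_lintegral_cosetMeasure hw'
  -- With this invariant `F`, the inner integral on each side cancels one of the two inverse factors
  -- and leaves the density of one weight.
  have key := H.lintegral_mul_lintegral_cosetMeasure
    (F := A.indicator fun y => (∫⁻ k, w k ∂H.cosetMeasure y)⁻¹ * (∫⁻ k, w' k ∂H.cosetMeasure y)⁻¹)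
    ((hm.inv.mul hm'.inv).indicator hA) hw hw' (by
      intro h hh y
      by_cases hy : y ∈ A
      · rw [Set.indicator_of_mem hy, Set.indicator_of_mem ((hinv h hh y).2 hy),
          H.cosetMeasure_mul_of_mem hh]
      · rw [Set.indicator_of_notMem hy, Set.indicator_of_notMem (mt (hinv h hh y).1 hy)])
  rw [← lintegral_indicator hA, ← lintegral_indicator hA]
  convert! key using 2
  · ext y
    by_cases hy : y ∈ A
    · simp only [Set.indicator_of_mem hy, transverseDensity]
      rw [mul_right_comm, mul_assoc _ _ (∫⁻ k, w' k ∂H.cosetMeasure y),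
        ENNReal.inv_mul_cancel (h0' y) (ht' y)]
      ring
    · simp [hy]
  · ext y
    by_cases hy : y ∈ A
    · simp only [Set.indicator_of_mem hy, transverseDensity]
      rw [mul_right_comm _ (w' y), mul_right_comm _ (_ : ℝ≥0∞)⁻¹,
        ENNReal.inv_mul_cancel (h0 y) (ht y), one_mul, mul_comm]
    · simp [hy]

/-- A measure on `G` whose restriction to the left `H`-invariant sets is the invariant measure of
`H \ G`. -/
noncomputable def transverse (H : ClosedSubgroup G) : Measure G :=
  Measure.haar.withDensity (H.transverseDensity (weight G))

instance (H : ClosedSubgroup G) : SigmaFinite H.transverse := by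
  refine SigmaFinite.withDensity_of_ne_top (Eventually.of_forall fun y => ?_)
  exact ENNReal.mul_ne_top (weight_ne_top y) (ENNReal.inv_ne_top.2
    (H.lintegral_cosetMeasure_ne_zero y measurable_weight weight_ne_zero))

theorem transverse_ne_zero (H : ClosedSubgroup G) : H.transverse Set.univ ≠ 0 := by
  intro h0
  rw [transverse, withDensity_apply _ MeasurableSet.univ, Measure.restrict_univ,
    lintegral_eq_zero_iff (H.measurable_transverseDensity measurable_weight)] at h0
  have : (Measure.haar : Measure G) Set.univ = 0 := by
    refine measure_mono_null (fun k _ => ?_) h0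
    exact mul_ne_zero (weight_ne_zero k) (ENNReal.inv_ne_zero.2 (H.lintegral_weight_ne_top k))
  exact NeZero.ne _ (Measure.measure_univ_eq_zero.1 this)

/-- Translation by g turns the weight into its translate and the coset measures of H into those of
gHg⁻¹. On invariant sets the change of weight has no effect. -/
theorem transverse_smul (g : G) (H : ClosedSubgroup G) {A : Set G} (hA : MeasurableSet A)
    (hinv : ∀ h ∈ g • H, ∀ y, h * y ∈ A ↔ y ∈ A) :
    (g • H).transverse A = H.transverse ((g * ·) ⁻¹' A) := by
  have hA' : MeasurableSet ((g * ·) ⁻¹' A) := measurable_const_mul g hA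
  have hwg : Measurable fun k => weight G (g * k) := measurable_weight.comp (measurable_const_mul g)
  have hint : ∀ y, ∫⁻ k, weight G (g * k) ∂H.cosetMeasure y =
      ∫⁻ k, weight G k ∂(g • H).cosetMeasure (g * y) := by
    intro y
    rw [cosetMeasure_smul, lintegral_map measurable_weight (measurable_const_mul g)]
  rw [transverse, withDensity_apply _ hA, transverse, withDensity_apply _ hA',
    H.setLIntegral_transverseDensity_congr measurable_weight hwg
      (fun y => H.lintegral_cosetMeasure_ne_zero y measurable_weight weight_ne_zero)
      H.lintegral_weight_ne_top
      (fun y => H.lintegral_cosetMeasure_ne_zero y hwg fun k => weight_ne_zero _)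
      (fun y => by rw [hint]; exact lintegral_weight_ne_top _ _) hA',
    ← lintegral_indicator hA, ← lintegral_indicator hA', ← lintegral_mul_left_eq_self _ g]
  · refine lintegral_congr fun y => ?_
    by_cases hy : g * y ∈ A
    · rw [Set.indicator_of_mem hy, Set.indicator_of_mem (show y ∈ (g * ·) ⁻¹' A from hy),
        transverseDensity, transverseDensity, hint]
    · rw [Set.indicator_of_notMem hy, Set.indicator_of_notMem (show y ∉ (g * ·) ⁻¹' A from hy)]
  · intro h hh y
    have hmem : g * h * g⁻¹ ∈ g • H := by
      rw [← SetLike.mem_coe, coe_smul]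
      exact ⟨h, hh, rfl⟩
    have := hinv _ hmem (g * y)
    simpa [mul_assoc] using this

/-- The transverse measure is finite on saturations of compact sets. -/
theorem transverse_lt_top (H : ClosedSubgroup G) {A K : Set G} (hK : IsCompact K)
    (hA : MeasurableSet A) (hinv : ∀ h ∈ H, ∀ y, h * y ∈ A ↔ y ∈ A)
    (hAK : ∀ y ∈ A, ∃ h ∈ H, h * y ∈ K) : H.transverse A < ∞ := by
  -- Every coset that meets K in a point z gives mass at least one to C, since C contains z ·
  -- `unitNhd G`. This bounds the transverse mass of A by the Haar measure of C.
  have hC : IsCompact ((fun p : G × G => p.1 * p.2) '' (K ×ˢ closure (unitNhd G))) :=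
    (hK.prod isCompact_closure_unitNhd).image (by fun_prop)
  set C := (fun p : G × G => p.1 * p.2) '' (K ×ˢ closure (unitNhd G))
  have hCm : MeasurableSet C := hC.isClosed.measurableSet
  have hm := H.measurable_lintegral_cosetMeasure (measurable_weight (G := G))
  have key := H.lintegral_mul_lintegral_cosetMeasure
    (F := A.indicator fun y => (∫⁻ k, weight G k ∂H.cosetMeasure y)⁻¹)
    (b := C.indicator 1)
    (hm.inv.indicator hA) measurable_weight (measurable_one.indicator hCm) (by
      intro h hh y
      by_cases hy : y ∈ A
      · rw [Set.indicator_of_mem hy, Set.indicator_of_mem ((hinv h hh y).2 hy),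
          H.cosetMeasure_mul_of_mem hh]
      · rw [Set.indicator_of_notMem hy, Set.indicator_of_notMem (mt (hinv h hh y).1 hy)])
  have hone : ∀ y ∈ A, 1 ≤ ∫⁻ k, C.indicator 1 k ∂H.cosetMeasure y := by
    intro y hy
    obtain ⟨h, hh, hyK⟩ := hAK y hy
    rw [lintegral_indicator_one hCm, ← H.cosetMeasure_mul_of_mem hh,
      ← H.cosetMeasure_unitNhd (h * y)]
    exact measure_mono fun k hk =>
      ⟨(h * y, (h * y)⁻¹ * k), ⟨hyK, subset_closure hk⟩, by simp [mul_assoc]⟩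
  calc H.transverse A
      = ∫⁻ y, A.indicator (H.transverseDensity (weight G)) y ∂Measure.haar := by
        rw [transverse, withDensity_apply _ hA, lintegral_indicator hA]
    _ ≤ ∫⁻ y, A.indicator (fun y => (∫⁻ k, weight G k ∂H.cosetMeasure y)⁻¹) y * weight G y *
          ∫⁻ k, C.indicator 1 k ∂H.cosetMeasure y ∂Measure.haar := by
        refine lintegral_mono fun y => ?_
        by_cases hy : y ∈ A
        · simp only [Set.indicator_of_mem hy, transverseDensity]
          rw [mul_comm (weight G y)]
          exact le_mul_of_one_le_right' (hone y hy)
        · simp [hy]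
    _ = ∫⁻ y, A.indicator (fun y => (∫⁻ k, weight G k ∂H.cosetMeasure y)⁻¹) y * C.indicator 1 y *
          ∫⁻ k, weight G k ∂H.cosetMeasure y ∂Measure.haar := key
    _ ≤ ∫⁻ y, C.indicator 1 y ∂Measure.haar := by
        refine lintegral_mono fun y => ?_
        by_cases hy : y ∈ A
        · simp only [Set.indicator_of_mem hy]
          rw [mul_right_comm, ENNReal.inv_mul_cancel (H.lintegral_cosetMeasure_ne_zero y
            measurable_weight weight_ne_zero) (H.lintegral_weight_ne_top y), one_mul]
        · simp [hy]
    _ = Measure.haar C := lintegral_indicator_one hCm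
    _ < ∞ := hC.measure_lt_top

end ClosedSubgroup

/-! ### Saturations under a closed subgroup -/

namespace ClosedSubgroup

open scoped ENNReal
open TopologicalSpace EffrosSpace ProbabilityTheory

variable {G : Type*} [Group G] [TopologicalSpace G]

/-- The set of points that some element of `H` moves into `U`. -/
def saturation {E : Type*} [MulAction G E] (H : ClosedSubgroup G) (U : Set E) : Set E :=
  {x | ∃ h ∈ H, h • x ∈ U}

theorem isOpen_saturation {E : Type*} [MulAction G E] [TopologicalSpace E]
    [ContinuousConstSMul G E] (H : ClosedSubgroup G) {U : Set E} (hU : IsOpen U) :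
    IsOpen (H.saturation U) := by
  have : H.saturation U = ⋃ h ∈ H, (fun x => h • x) ⁻¹' U := by
    ext x
    simp [saturation]
  rw [this]
  exact isOpen_biUnion fun h _ => hU.preimage (continuous_const_smul h)

theorem smul_mem_saturation {E : Type*} [MulAction G E] (H : ClosedSubgroup G) {U : Set E}
    {h : G} (hh : h ∈ H) (x : E) : h • x ∈ H.saturation U ↔ x ∈ H.saturation U := by
  constructor
  · rintro ⟨k, hk, hx⟩
    exact ⟨k * h, mul_mem hk hh, by rwa [mul_smul]⟩
  · rintro ⟨k, hk, hx⟩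
    exact ⟨k * h⁻¹, mul_mem hk (inv_mem hh), by simpa [mul_smul] using hx⟩

theorem measurableSet_saturation {E : Type*} [MulAction G E] [TopologicalSpace E]
    [ContinuousSMul G E] [SecondCountableTopology G] [SecondCountableTopology E]
    [MeasurableSpace E] [BorelSpace E] {U : Set E} (hU : IsOpen U) :
    MeasurableSet {p : ClosedSubgroup G × E | p.2 ∈ p.1.saturation U} := by
  have : {p : ClosedSubgroup G × E | p.2 ∈ p.1.saturation U} =
      ⋃ q : {q : countableBasis G × countableBasis E //
        ∀ g ∈ (q.1 : Set G), ∀ x ∈ (q.2 : Set E), g • x ∈ U},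
        (toEffros ⁻¹' hit (q.1.1 : Set G)) ×ˢ (q.1.2 : Set E) := by
    ext ⟨H, x⟩
    simp only [Set.mem_ofPred_eq, Set.mem_iUnion, Set.mem_prod, Set.mem_preimage, mem_hit]
    constructor
    · rintro ⟨h, hh, hx⟩
      have hopen : IsOpen {p : G × E | p.1 • p.2 ∈ U} := hU.preimage continuous_smul
      obtain ⟨A, B, hA, hB, hgA, hxB, hAB⟩ := isOpen_prod_iff.1 hopen h x hx
      obtain ⟨V, hgV, hVA⟩ := exists_basis hA hgA
      obtain ⟨W, hxW, hWB⟩ := exists_basis hB hxB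
      exact ⟨⟨(V, W), fun g' hg' x' hx' => hAB (Set.mk_mem_prod (hVA hg') (hWB hx'))⟩,
        ⟨h, hh, hgV⟩, hxW⟩
    · rintro ⟨⟨⟨V, W⟩, hVW⟩, ⟨h, hh, hhV⟩, hxW⟩
      exact ⟨h, hh, hVW h hhV x hxW⟩
  rw [this]
  exact MeasurableSet.iUnion fun q => (measurable_toEffros
    (measurableSet_hit (isOpen_basis q.1.1))).prod (isOpen_basis q.1.2).measurableSet

variable [IsTopologicalGroup G] [T2Space G] [LocallyCompactSpace G] [SecondCountableTopology G]
  [MeasurableSpace G] [BorelSpace G]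

/-! ### The transverse density is measurable in the subgroup -/

/-- The right coset `H y`. -/
def coset (p : ClosedSubgroup G × G) : EffrosSpace G := ofClosure {k | ∃ h ∈ p.1, k = h * p.2}

theorem measurable_coset : Measurable (coset : ClosedSubgroup G × G → EffrosSpace G) := by
  refine measurable_of_hit fun U hU => ?_
  have : {p : ClosedSubgroup G × G | ((coset p : Set G) ∩ U).Nonempty} =
      {p | p.2 ∈ p.1.saturation U} := by
    ext ⟨H, y⟩
    simp only [Set.mem_ofPred_eq, coset, ofClosure_inter_nonempty hU]
    constructor
    · rintro ⟨k, ⟨h, hh, rfl⟩, hk⟩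
      exact ⟨h, hh, hk⟩
    · rintro ⟨h, hh, hk⟩
      exact ⟨_, ⟨h, hh, rfl⟩, hk⟩
  rw [this]
  exact measurableSet_saturation hU

theorem exists_mul_eq_of_coset_eq (H : ClosedSubgroup G) {x y : G}
    (h : coset (H, x) = coset (H, y)) : ∃ k ∈ H, x = k * y := by
  have hcl : IsClosed {k : G | ∃ h ∈ H, k = h * y} := by
    have : {k : G | ∃ h ∈ H, k = h * y} = (fun k => k * y⁻¹) ⁻¹' (H : Set G) := by
      ext k
      constructor
      · rintro ⟨h, hh, rfl⟩
        simpa using hh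
      · intro hk
        exact ⟨_, hk, by simp⟩
    rw [this]
    exact H.isClosed'.preimage (by fun_prop)
  have hx : x ∈ (coset (H, y) : Set G) := by
    rw [← h]
    exact subset_closure ⟨1, one_mem H, by simp⟩
  rw [coset, coe_ofClosure, hcl.closure_eq] at hx
  exact hx

/-- Borel functions that are constant on cosets factor through the space of cosets. -/
theorem exists_factor_coset (H : ClosedSubgroup G) {f : G → ℝ≥0∞} (hf : Measurable f)
    (hinv : ∀ h ∈ H, ∀ y, f (h * y) = f y) :
    ∃ f' : EffrosSpace G → ℝ≥0∞, Measurable f' ∧ ∀ y, f y = f' (coset (H, y)) := by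
  have hq : Measurable fun y => coset (H, y) := measurable_coset.comp measurable_prodMk_left
  have := standardBorelSpace_of_locallyCompact G
  have hcomap : Measurable[MeasurableSpace.comap (fun y => coset (H, y)) inferInstance] f := by
    intro T hT
    have hA : f ⁻¹' T = (fun y => coset (H, y)) ⁻¹' ((fun y => coset (H, y)) '' (f ⁻¹' T)) := by
      refine Set.Subset.antisymm (Set.subset_preimage_image _ _) ?_
      rintro y ⟨x, hx, hxy⟩
      obtain ⟨k, hk, rfl⟩ := H.exists_mul_eq_of_coset_eq hxy
      rwa [Set.mem_preimage, hinv k hk] at hx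
    have h1 := hf hT
    -- Souslin separation: for a Borel map on a standard Borel space, a set with Borel preimage is
    -- Borel relative to the range. A priori the image is only analytic.
    rw [hA, hq.measurableSet_preimage_iff_preimage_val] at h1
    obtain ⟨T', hT', hTT'⟩ := h1
    refine ⟨T', hT', ?_⟩
    rw [hA]
    ext y
    have := Set.ext_iff.1 hTT' ⟨coset (H, y), y, rfl⟩
    exact this
  obtain ⟨f', hf', h⟩ := hcomap.exists_eq_measurable_comp
  exact ⟨f', hf', congrFun h⟩

/-- The finite measure with density `weight` with respect to Haar measure. -/
noncomputable def weightMeasure (G : Type*) [Group G] [TopologicalSpace G] [IsTopologicalGroup G]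
    [T2Space G] [LocallyCompactSpace G] [SecondCountableTopology G] [MeasurableSpace G]
    [BorelSpace G] : Measure G :=
  Measure.haar.withDensity (weight G)

instance : IsFiniteMeasure (weightMeasure G) :=
  isFiniteMeasure_withDensity lintegral_weight_haar_ne_top

/-- The joint law of the coset and the point. -/
noncomputable def cosetKernel (G : Type*) [Group G] [TopologicalSpace G] [IsTopologicalGroup G]
    [T2Space G] [LocallyCompactSpace G] [SecondCountableTopology G] [MeasurableSpace G]
    [BorelSpace G] : Kernel (ClosedSubgroup G) (EffrosSpace G × G) :=
  (Kernel.id ×ₖ Kernel.const _ (weightMeasure G)).map fun p => (coset p, p.2)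

instance : IsFiniteKernel (cosetKernel G) := by
  unfold cosetKernel
  infer_instance

theorem cosetKernel_apply (H : ClosedSubgroup G) :
    cosetKernel G H = (weightMeasure G).map fun y => (coset (H, y), y) := by
  have hm : Measurable fun p : ClosedSubgroup G × G => (coset p, p.2) :=
    measurable_coset.prodMk measurable_snd
  rw [cosetKernel, Kernel.map_apply _ hm, Kernel.prod_apply, Kernel.id_apply, Kernel.const_apply,
    Measure.dirac_prod, Measure.map_map hm measurable_prodMk_left]
  rfl

theorem cosetKernel_fst (H : ClosedSubgroup G) :
    (cosetKernel G).fst H = (weightMeasure G).map fun y => coset (H, y) := by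
  have hq : Measurable fun y => coset (H, y) := measurable_coset.comp measurable_prodMk_left
  rw [Kernel.fst_apply, cosetKernel_apply, Measure.map_map measurable_fst (hq.prodMk measurable_id')]
  rfl

/-- The normalized coset measure with density `weight`. -/
noncomputable def condCoset (H : ClosedSubgroup G) (y : G) : Measure G :=
  (∫⁻ k, weight G k ∂H.cosetMeasure y)⁻¹ • (H.cosetMeasure y).withDensity (weight G)

instance (H : ClosedSubgroup G) (y : G) : IsProbabilityMeasure (H.condCoset y) := ⟨by
  rw [condCoset, Measure.smul_apply, withDensity_apply _ MeasurableSet.univ, Measure.restrict_univ]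
  exact ENNReal.inv_mul_cancel (H.lintegral_cosetMeasure_ne_zero y measurable_weight weight_ne_zero)
    (H.lintegral_weight_ne_top y)⟩

theorem condCoset_apply (H : ClosedSubgroup G) (y : G) {B : Set G} (hB : MeasurableSet B) :
    H.condCoset y B = (∫⁻ k, weight G k ∂H.cosetMeasure y)⁻¹ *
      ∫⁻ k, B.indicator (weight G) k ∂H.cosetMeasure y := by
  rw [condCoset, Measure.smul_apply, withDensity_apply _ hB, lintegral_indicator hB, smul_eq_mul]

/-- Both sides are functions of the coset, so it suffices to compare their integrals over sets of
cosets. That comparison is `lintegral_mul_lintegral_cosetMeasure` with the weight and its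
restriction to B as the two test functions. -/
theorem condKernel_ae_eq_of_measurableSet (H : ClosedSubgroup G) {B : Set G}
    (hB : MeasurableSet B) :
    have := standardBorelSpace_of_locallyCompact G
    ∀ᵐ y ∂weightMeasure G, (cosetKernel G).condKernel (H, coset (H, y)) B = H.condCoset y B := by
  intro _
  have hq : Measurable fun y => coset (H, y) := measurable_coset.comp measurable_prodMk_left
  have hwB : Measurable (B.indicator (weight G)) := measurable_weight.indicator hB
  have hmw := H.measurable_lintegral_cosetMeasure (measurable_weight (G := G))
  have hmB := H.measurable_lintegral_cosetMeasure hwB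
  have hm : Measurable fun y => H.condCoset y B := by
    simp_rw [H.condCoset_apply _ hB]
    exact hmw.inv.mul hmB
  obtain ⟨f', hf', hff'⟩ := H.exists_factor_coset hm (by
    intro h hh y
    rw [condCoset, condCoset, H.cosetMeasure_mul_of_mem hh])
  have hk : Measurable fun C => (cosetKernel G).condKernel (H, C) B :=
    ((cosetKernel G).condKernel.measurable_coe hB).comp measurable_prodMk_left
  have key : (fun C => (cosetKernel G).condKernel (H, C) B) =ᵐ[(cosetKernel G).fst H] f' := by
    refine ae_eq_of_forall_setLIntegral_eq_of_sigmaFinite hk hf' fun T hT _ => ?_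
    rw [setLIntegral_condKernel_eq_measure_prod H hT hB, cosetKernel_fst,
      setLIntegral_map hT hf' hq, cosetKernel_apply,
      Measure.map_apply (hq.prodMk measurable_id') (hT.prod hB)]
    simp_rw [← hff']
    set A := (fun y => coset (H, y)) ⁻¹' T with hA_def
    have hA : MeasurableSet A := hq hT
    have hAinv : ∀ h ∈ H, ∀ y, h * y ∈ A ↔ y ∈ A := by
      intro h hh y
      have : coset (H, h * y) = coset (H, y) := by
        unfold coset
        congr 1
        ext k
        constructor
        · rintro ⟨l, hl, rfl⟩
          exact ⟨l * h, mul_mem hl hh, by simp [mul_assoc]⟩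
        · rintro ⟨l, hl, rfl⟩
          exact ⟨l * h⁻¹, mul_mem hl (inv_mem hh), by simp [mul_assoc]⟩
      rw [hA_def, Set.mem_preimage, Set.mem_preimage, this]
    have hpre : (fun y => (coset (H, y), y)) ⁻¹' T ×ˢ B = A ∩ B := rfl
    have swap := H.lintegral_mul_lintegral_cosetMeasure
      (F := A.indicator fun y => (∫⁻ k, weight G k ∂H.cosetMeasure y)⁻¹)
      (hmw.inv.indicator hA) (measurable_weight (G := G)) hwB (by
      intro h hh y
      by_cases hy : y ∈ A
      · rw [Set.indicator_of_mem hy, Set.indicator_of_mem ((hAinv h hh y).2 hy),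
          H.cosetMeasure_mul_of_mem hh]
      · rw [Set.indicator_of_notMem hy, Set.indicator_of_notMem (mt (hAinv h hh y).1 hy)])
    rw [hpre, weightMeasure, withDensity_apply _ (hA.inter hB),
      setLIntegral_withDensity_eq_setLIntegral_mul _ measurable_weight hm hA,
      ← lintegral_indicator (hA.inter hB), ← lintegral_indicator hA]
    refine Eq.trans ?_ (swap.symm.trans ?_)
    · refine lintegral_congr fun y => ?_
      by_cases hy : y ∈ A
      · rw [Set.indicator_of_mem hy]
        by_cases hyB : y ∈ B
        · rw [Set.indicator_of_mem hyB, Set.indicator_of_mem (Set.mem_inter hy hyB),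
            mul_right_comm, ENNReal.inv_mul_cancel (H.lintegral_cosetMeasure_ne_zero y
            measurable_weight weight_ne_zero) (H.lintegral_weight_ne_top y), one_mul]
        · rw [Set.indicator_of_notMem hyB, Set.indicator_of_notMem fun h => hyB h.2]
          simp
      · rw [Set.indicator_of_notMem hy, Set.indicator_of_notMem fun h => hy h.1]
        simp
    · refine lintegral_congr fun y => ?_
      by_cases hy : y ∈ A
      · rw [Set.indicator_of_mem hy, Set.indicator_of_mem hy, Pi.mul_apply,
          H.condCoset_apply y hB]
        ring
      · simp [hy]
  rw [cosetKernel_fst] at key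
  filter_upwards [ae_of_ae_map hq.aemeasurable key] with y hy
  rw [hy, hff']

/-- A countable algebra generates the Borel sets of G, so the exceptional null sets of its members
can be united. -/
theorem condKernel_ae_eq (H : ClosedSubgroup G) :
    have := standardBorelSpace_of_locallyCompact G
    ∀ᵐ y ∂weightMeasure G, (cosetKernel G).condKernel (H, coset (H, y)) = H.condCoset y := by
  intro _
  set 𝒜 := generateSetAlgebra (MeasurableSpace.countableGeneratingSet G) with h𝒜
  have hgen : (inferInstance : MeasurableSpace G) = MeasurableSpace.generateFrom 𝒜 := by
    rw [h𝒜, generateFrom_generateSetAlgebra_eq,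
      MeasurableSpace.generateFrom_countableGeneratingSet]
  have hmeas : ∀ B ∈ 𝒜, MeasurableSet B := fun B hB => by
    have h : MeasurableSet[MeasurableSpace.generateFrom 𝒜] B :=
      MeasurableSpace.measurableSet_generateFrom hB
    rw [← hgen] at h
    exact h
  have hcount : 𝒜.Countable := countable_generateSetAlgebra
    MeasurableSpace.countable_countableGeneratingSet
  have hae := (ae_ball_iff hcount).2 fun B hB => H.condKernel_ae_eq_of_measurableSet (hmeas B hB)
  filter_upwards [hae] with y hy
  exact ext_of_generate_finite 𝒜 hgen
    (fun s hs t ht _ => isSetAlgebra_generateSetAlgebra.inter_mem hs ht) hy (by simp)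

/-- The transverse density has a version that is jointly measurable in the subgroup and the
point. -/
theorem exists_measurable_transverseDensity :
    ∃ β : ClosedSubgroup G × G → ℝ≥0∞, Measurable β ∧
      ∀ H : ClosedSubgroup G, H.transverseDensity (weight G) =ᵐ[Measure.haar] fun y => β (H, y) := by
  have := standardBorelSpace_of_locallyCompact G
  let S : Set ((ClosedSubgroup G × G) × G) := {p | p.1.2⁻¹ * p.2 ∈ unitNhd G}
  have hS : MeasurableSet S :=
    (measurable_fst.snd.inv.mul measurable_snd) isOpen_unitNhd.measurableSet
  have hc : Measurable fun p : ClosedSubgroup G × G => (p.1, coset p) :=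
    measurable_fst.prodMk measurable_coset
  -- The kernel is jointly measurable, unlike the separately chosen Haar measures. Integrating the
  -- indicator of y · `unitNhd G` divided by the weight against `condCoset` gives the inverse of the
  -- total weight of the coset, because that neighbourhood has coset measure one.
  let κ := (cosetKernel G).condKernel.comap _ hc
  let f : ClosedSubgroup G × G → G → ℝ≥0∞ := fun p k => S.indicator (fun q => (weight G q.2)⁻¹) (p, k)
  have hf : Measurable (Function.uncurry f) := (measurable_weight.comp measurable_snd).inv.indicator hS
  refine ⟨fun p => weight G p.2 * ∫⁻ k, f p k ∂κ p,
    (measurable_weight.comp measurable_snd).mul hf.lintegral_kernel_prod_right, fun H => ?_⟩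
  have hae := H.condKernel_ae_eq
  rw [weightMeasure, ae_withDensity_iff measurable_weight] at hae
  filter_upwards [hae] with y hy
  have hκ : κ (H, y) = H.condCoset y := hy (weight_ne_zero y)
  have hBm : MeasurableSet {k | y⁻¹ * k ∈ unitNhd G} :=
    (measurable_const_mul y⁻¹) isOpen_unitNhd.measurableSet
  have hfy : Measurable (f (H, y)) := hf.comp measurable_prodMk_left
  rw [hκ, condCoset, lintegral_smul_measure, lintegral_withDensity_eq_lintegral_mul _
    measurable_weight hfy, transverseDensity, smul_eq_mul]
  congr 1
  have : ∀ k, (weight G * f (H, y)) k = {k | y⁻¹ * k ∈ unitNhd G}.indicator 1 k := by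
    intro k
    by_cases hk : k ∈ {k | y⁻¹ * k ∈ unitNhd G}
    · rw [Set.indicator_of_mem hk, Pi.mul_apply]
      have : f (H, y) k = (weight G k)⁻¹ := Set.indicator_of_mem (s := S) hk _
      rw [this, ENNReal.mul_inv_cancel (weight_ne_zero k) (weight_ne_top k)]
      rfl
    · rw [Set.indicator_of_notMem hk, Pi.mul_apply]
      have : f (H, y) k = 0 := Set.indicator_of_notMem (s := S) hk _
      rw [this, mul_zero]
  simp_rw [this]
  rw [lintegral_indicator_one hBm, H.cosetMeasure_unitNhd, mul_one]

end ClosedSubgroup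

/-! ### Poisson processes -/

namespace PoissonProcess

open scoped ENNReal NNReal
open ProbabilityTheory

/-- The probability that a Poisson variable of mean `a` vanishes, also for `a = ∞`. -/
noncomputable def void (a : ℝ≥0∞) : ℝ≥0∞ := EReal.exp (-(a : EReal))

theorem continuous_void : Continuous void :=
  ENNReal.continuous_exp.comp (continuous_neg.comp continuous_coe_ennreal_ereal)

theorem void_zero : void 0 = 1 := by simp [void]

theorem void_top : void ∞ = 0 := by simp [void]

theorem void_add (a b : ℝ≥0∞) : void (a + b) = void a * void b := by
  rw [void, void, void, ← EReal.exp_add, EReal.coe_ennreal_add, EReal.neg_add (by simp) (by simp),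
    sub_eq_add_neg]

theorem void_ofReal {x : ℝ} (hx : 0 ≤ x) : void (ENNReal.ofReal x) = ENNReal.ofReal (Real.exp (-x)) := by
  rw [void, EReal.coe_ennreal_ofReal, max_eq_left hx, ← EReal.coe_neg, EReal.exp_coe]

theorem void_le_one (a : ℝ≥0∞) : void a ≤ 1 := by
  rw [← void_zero, void, void]
  refine EReal.exp_monotone ?_
  rw [EReal.neg_le_neg_iff]
  exact_mod_cast zero_le (a := a)

theorem one_sub_void_le (a : ℝ≥0∞) : 1 - void a ≤ a := by
  rcases eq_or_ne a ∞ with rfl | ha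
  · simp
  · obtain ⟨x, hx, rfl⟩ : ∃ x : ℝ, 0 ≤ x ∧ a = ENNReal.ofReal x :=
      ⟨a.toReal, ENNReal.toReal_nonneg, (ENNReal.ofReal_toReal ha).symm⟩
    rw [void_ofReal hx, ← ENNReal.ofReal_one, ← ENNReal.ofReal_sub _ (Real.exp_pos _).le]
    exact ENNReal.ofReal_le_ofReal (by linarith [Real.add_one_le_exp (-x)])

theorem prod_void {ι : Type*} (s : Finset ι) (a : ι → ℝ≥0∞) :
    ∏ i ∈ s, void (a i) = void (∑ i ∈ s, a i) := by
  classical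
  induction s using Finset.induction_on with
  | empty => simp [void_zero]
  | insert i s hi ih => rw [Finset.prod_insert hi, Finset.sum_insert hi, void_add, ih]

theorem tprod_void {ι : Type*} (a : ι → ℝ≥0∞) : ∏' i, void (a i) = void (∑' i, a i) := by
  have h1 := (ENNReal.multipliable_of_le_one fun i => void_le_one (a i)).hasProd
  have h2 := (continuous_void.tendsto _).comp (ENNReal.summable (f := a)).hasSum
  refine tendsto_nhds_unique h1 (h2.congr fun s => ?_)
  exact (prod_void s a).symm

/-- This is the Poisson generating function: (1 - x)^n is the probability that n independent points
avoid a set of mass x. -/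
theorem lintegral_pow_poissonMeasure (r : ℝ≥0) {x : ℝ≥0∞} (hx : x ≤ 1) :
    ∫⁻ n, (1 - x) ^ n ∂poissonMeasure r = void (r * x) := by
  obtain ⟨y, hy0, hy1, rfl⟩ : ∃ y : ℝ, 0 ≤ y ∧ y ≤ 1 ∧ x = ENNReal.ofReal y :=
    ⟨x.toReal, ENNReal.toReal_nonneg, ENNReal.toReal_le_of_le_ofReal zero_le_one (by simpa using hx),
      (ENNReal.ofReal_toReal (hx.trans_lt ENNReal.one_lt_top).ne).symm⟩
  have h1y : 0 ≤ 1 - y := by linarith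
  rw [lintegral_countable']
  have hterm : ∀ n : ℕ, (1 - ENNReal.ofReal y) ^ n * poissonMeasure r {n} =
      ENNReal.ofReal (Real.exp (-r) * ((r * (1 - y)) ^ n / n.factorial)) := by
    intro n
    rw [poissonMeasure_singleton, ← ENNReal.ofReal_one, ← ENNReal.ofReal_sub _ hy0,
      ← ENNReal.ofReal_pow h1y, ← ENNReal.ofReal_mul (by positivity)]
    congr 1
    rw [mul_pow]
    ring
  have hsum : HasSum (fun n : ℕ => Real.exp (-r) * ((r * (1 - y)) ^ n / n.factorial))
      (Real.exp (-r) * Real.exp (r * (1 - y))) := by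
    rw [Real.exp_eq_exp_ℝ]
    exact (NormedSpace.expSeries_div_hasSum_exp ((r : ℝ) * (1 - y))).mul_left _
  simp_rw [hterm]
  rw [← ENNReal.ofReal_tsum_of_nonneg (fun n => by positivity) hsum.summable, hsum.tsum_eq,
    ← Real.exp_add]
  have : (r : ℝ≥0∞) * ENNReal.ofReal y = ENNReal.ofReal (r * y) := by
    rw [ENNReal.ofReal_mul (NNReal.coe_nonneg r), ENNReal.ofReal_coe_nnreal]
  rw [this, void_ofReal (by positivity)]
  congr 2
  ring

/-- In a product probability space, two real functions of different coordinates are almost surely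
different if one of them has no atoms. -/
theorem ae_ne_infinitePi {ι : Type*} {X : ι → Type*} [∀ i, MeasurableSpace (X i)]
    (μ : ∀ i, Measure (X i)) [∀ i, IsProbabilityMeasure (μ i)] {f : ∀ i, X i → ℝ}
    (hf : ∀ i, Measurable (f i)) {i j : ι} (hij : i ≠ j) (hatom : ∀ c, μ j (f j ⁻¹' {c}) = 0) :
    ∀ᵐ x ∂Measure.infinitePi μ, f i (x i) ≠ f j (x j) := by
  have hind := (iIndepFun_infinitePi (P := μ) (X := f) hf).indepFun hij
  have hmi : Measurable fun x : ∀ i, X i => f i (x i) := (hf i).comp (measurable_pi_apply i)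
  have hmj : Measurable fun x : ∀ i, X i => f j (x j) := (hf j).comp (measurable_pi_apply j)
  have hmap := (indepFun_iff_map_prod_eq_prod_map_map hmi.aemeasurable hmj.aemeasurable).1 hind
  have hdiag : MeasurableSet {p : ℝ × ℝ | p.1 = p.2} := measurableSet_eq_fun measurable_fst measurable_snd
  rw [ae_iff]
  simp only [ne_eq, not_not]
  have h1 : {x : ∀ i, X i | f i (x i) = f j (x j)} =
      (fun x => (f i (x i), f j (x j))) ⁻¹' {p : ℝ × ℝ | p.1 = p.2} := rfl
  rw [h1, ← Measure.map_apply (hmi.prodMk hmj) hdiag, hmap,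
    Measure.measure_prod_null hdiag]
  refine Eventually.of_forall fun c => ?_
  have h2 : Prod.mk c ⁻¹' {p : ℝ × ℝ | p.1 = p.2} = {c} := by
    ext d
    exact eq_comm
  beta_reduce
  rw [h2, Measure.map_apply hmj (measurableSet_singleton c)]
  have h3 : (fun x : ∀ i, X i => f j (x j)) ⁻¹' {c} = (fun x => x j) ⁻¹' (f j ⁻¹' {c}) := rfl
  rw [h3, ← Measure.map_apply (measurable_pi_apply j) (hf j (measurableSet_singleton c)),
    Measure.infinitePi_map_eval, hatom]
  rfl

/-- A nonzero `σ`-finite measure is a countable combination of absolutely continuous probability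
measures. -/
theorem exists_sum_probability {E : Type*} [MeasurableSpace E] (M : Measure E) [SFinite M]
    [NeZero M] : ∃ (r : ℕ → ℝ≥0) (p : ℕ → Measure E), (∀ i, IsProbabilityMeasure (p i)) ∧
      (∀ i, p i ≪ M) ∧ M = Measure.sum fun i => (r i : ℝ≥0∞) • p i := by
  classical
  set m := fun i => sfiniteSeq M i with hm
  refine ⟨fun i => (m i Set.univ).toNNReal,
    -- A vanishing piece has rate zero, so any probability measure absolutely continuous with
    -- respect to `M` can stand in for it; `M.toFinite` serves.
    fun i => if m i = 0 then M.toFinite else (m i Set.univ)⁻¹ • m i, fun i => ?_, fun i => ?_, ?_⟩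
  · by_cases h : m i = 0
    · simp only [h, if_true]
      infer_instance
    · simp only [h, if_false]
      have : NeZero (m i) := ⟨h⟩
      infer_instance
  · by_cases h : m i = 0
    · simp only [h, if_true]
      exact toFinite_absolutelyContinuous M
    · simp only [h, if_false]
      exact Measure.AbsolutelyContinuous.smul_left (Measure.absolutelyContinuous_of_le
        (sfiniteSeq_le M i)) _
  · conv_lhs => rw [← sum_sfiniteSeq M]
    congr 1
    ext1 i
    change m i = _
    by_cases h : m i = 0
    · simp [h]
    · have h0 : m i Set.univ ≠ 0 := fun h' => h (Measure.measure_univ_eq_zero.1 h')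
      beta_reduce
      rw [if_neg h, ENNReal.coe_toNNReal (measure_ne_top _ _), smul_smul,
        ENNReal.mul_inv_cancel h0 (measure_ne_top _ _), one_smul]

variable {E : Type*} [MeasurableSpace E]

/-- The sample space of a Poisson process: for every `i` a number of points and a sequence of
candidate points. -/
abbrev Sample (E : Type*) := ℕ → ℕ × (ℕ → E)

/-- The law of the candidate points and of their numbers. -/
noncomputable def law (r : ℕ → ℝ≥0) (p : ℕ → Measure E) [∀ i, IsProbabilityMeasure (p i)] :
    Measure (Sample E) :=
  Measure.infinitePi fun i => (poissonMeasure (r i)).prod (Measure.infinitePi fun _ : ℕ => p i)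

/-- The set of indices of the points of the process. -/
def active (ω : Sample E) : Set (ℕ × ℕ) := {q | q.2 < (ω q.1).1}

/-- The points of the process. -/
def point (ω : Sample E) (q : ℕ × ℕ) : E := (ω q.1).2 q.2

theorem measurable_point (q : ℕ × ℕ) : Measurable fun ω : Sample E => point ω q :=
  (measurable_pi_apply q.2).comp (measurable_snd.comp (measurable_pi_apply q.1))

theorem measurableSet_active (q : ℕ × ℕ) : MeasurableSet {ω : Sample E | q ∈ active ω} :=
  (measurable_fst.comp (measurable_pi_apply q.1)) (measurableSet_lt measurable_const measurable_id)

/-- No point of the `i`-th block lies in `A`. -/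
def avoid (A : Set E) : Set (ℕ × (ℕ → E)) := {z | ∀ j < z.1, z.2 j ∉ A}

theorem measurableSet_avoid {A : Set E} (hA : MeasurableSet A) : MeasurableSet (avoid A) := by
  have : avoid A = ⋂ j : ℕ, {z : ℕ × (ℕ → E) | j < z.1}ᶜ ∪ {z : ℕ × (ℕ → E) | z.2 j ∈ A}ᶜ := by
    ext z
    simp only [avoid, Set.mem_ofPred_eq, Set.mem_iInter, Set.mem_union, Set.mem_compl_iff]
    exact forall_congr' fun j => imp_iff_not_or
  rw [this]
  refine MeasurableSet.iInter fun j => (MeasurableSet.compl ?_).union (MeasurableSet.compl ?_)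
  · exact measurable_fst (measurableSet_lt measurable_const measurable_id)
  · exact ((measurable_pi_apply j).comp measurable_snd) hA

theorem measure_avoid (r : ℝ≥0) (p : Measure E) [IsProbabilityMeasure p] {A : Set E}
    (hA : MeasurableSet A) :
    ((poissonMeasure r).prod (Measure.infinitePi fun _ : ℕ => p)) (avoid A) = void (r * p A) := by
  rw [Measure.prod_apply (measurableSet_avoid hA), ← lintegral_pow_poissonMeasure r prob_le_one]
  refine lintegral_congr fun n => ?_
  have : Prod.mk n ⁻¹' avoid A = Set.pi (Finset.range n : Set ℕ) fun _ => Aᶜ := by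
    ext z
    simp [avoid, Set.mem_pi]
  rw [this, Measure.infinitePi_pi _ fun _ _ => hA.compl]
  simp [prob_compl_eq_one_sub hA]

variable (r : ℕ → ℝ≥0) (p : ℕ → Measure E) [∀ i, IsProbabilityMeasure (p i)]

instance : IsProbabilityMeasure (law r p) := by
  unfold law
  infer_instance

/-- Blocks are independent, so their void probabilities multiply while the means in the exponent
add. -/
theorem law_void {A : Set E} (hA : MeasurableSet A) :
    law r p {ω | ∀ q ∈ active ω, point ω q ∉ A} =
      void ((Measure.sum fun i => (r i : ℝ≥0∞) • p i) A) := by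
  have : {ω : Sample E | ∀ q ∈ active ω, point ω q ∉ A} = Set.univ.pi fun _ => avoid A := by
    ext ω
    simp only [Set.mem_ofPred_eq, Set.mem_pi, Set.mem_univ, true_imp_iff, avoid, active, point]
    exact ⟨fun h i j hj => h (i, j) hj, fun h q hq => h q.1 q.2 hq⟩
  rw [this, law, Measure.infinitePi_pi_univ _ fun _ => measurableSet_avoid hA]
  simp_rw [measure_avoid _ _ hA]
  rw [tprod_void, Measure.sum_apply _ hA]
  rfl

/-- Borel–Cantelli: block i meets A with probability at most its mean number of points in A, and
these means are summable. So only finitely many blocks contribute, each with finitely many points.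
-/
theorem law_finite {A : Set E} (hA : MeasurableSet A)
    (hfin : (Measure.sum fun i => (r i : ℝ≥0∞) • p i) A ≠ ∞) :
    ∀ᵐ ω ∂law r p, {q | q ∈ active ω ∧ point ω q ∈ A}.Finite := by
  have hsum : ∑' i, law r p ((fun ω => ω i) ⁻¹' (avoid A)ᶜ) ≠ ∞ := by
    refine ne_top_of_le_ne_top hfin ?_
    rw [Measure.sum_apply _ hA]
    refine ENNReal.tsum_le_tsum fun i => ?_
    rw [law, ← Measure.map_apply (measurable_pi_apply i) (measurableSet_avoid hA).compl,
      Measure.infinitePi_map_eval, prob_compl_eq_one_sub (measurableSet_avoid hA),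
      measure_avoid _ _ hA]
    exact one_sub_void_le _
  filter_upwards [ae_finite_setOfPred_mem hsum] with ω hω
  refine (hω.biUnion fun i _ => ((Set.finite_lt_nat (ω i).1).image fun j => (i, j))).subset ?_
  rintro ⟨i, j⟩ ⟨hq, hqA⟩
  simp only [Set.mem_iUnion]
  exact ⟨i, fun h => h j hq hqA, j, hq, rfl⟩

/-- Two distinct indices give independent points, in the same block or in different ones, and an
atomless label coincides with an independent one with probability zero. There are countably many
pairs of indices. -/
theorem law_injective {t : E → ℝ} (ht : Measurable t)
    (hatom : ∀ c, (Measure.sum fun i => (r i : ℝ≥0∞) • p i) (t ⁻¹' {c}) = 0)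
    (hac : ∀ i, p i ≪ Measure.sum fun i => (r i : ℝ≥0∞) • p i) :
    ∀ᵐ ω ∂law r p, ∀ q q' : ℕ × ℕ, q ≠ q' → t (point ω q) ≠ t (point ω q') := by
  have hpt : ∀ i c, p i (t ⁻¹' {c}) = 0 := fun i c => hac i (hatom c)
  rw [ae_all_iff]
  intro q
  rw [ae_all_iff]
  intro q'
  by_cases hq : q = q'
  · exact Eventually.of_forall fun _ h => absurd hq h
  obtain ⟨i, j⟩ := q
  obtain ⟨i', j'⟩ := q'
  by_cases hi : i = i'
  · subst hi
    have hj : j ≠ j' := fun h => hq (by rw [h])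
    have h1 : ∀ᵐ ξ ∂Measure.infinitePi fun _ : ℕ => p i, t (ξ j) ≠ t (ξ j') :=
      ae_ne_infinitePi (fun _ : ℕ => p i) (f := fun _ => t) (fun _ => ht) hj (hpt i)
    have h2 : ∀ᵐ z ∂(poissonMeasure (r i)).prod (Measure.infinitePi fun _ : ℕ => p i),
        t (z.2 j) ≠ t (z.2 j') := Measure.quasiMeasurePreserving_snd.ae h1
    have h3 : ∀ᵐ ω ∂law r p, t ((ω i).2 j) ≠ t ((ω i).2 j') := by
      refine ae_of_ae_map (μ := law r p) (measurable_pi_apply i).aemeasurable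
        (p := fun z : ℕ × (ℕ → E) => t (z.2 j) ≠ t (z.2 j')) ?_
      rwa [law, Measure.infinitePi_map_eval]
    filter_upwards [h3] with ω hω _ using hω
  · -- the two points belong to independent blocks
    have hf : ∀ k, Measurable fun z : ℕ × (ℕ → E) => t (z.2 (if k = i then j else j')) := fun k =>
      ht.comp ((measurable_pi_apply _).comp measurable_snd)
    have h1 := ae_ne_infinitePi (fun i => (poissonMeasure (r i)).prod
      (Measure.infinitePi fun _ : ℕ => p i)) hf hi fun c => by
        have hS : MeasurableSet (t ⁻¹' {c}) := ht (measurableSet_singleton c)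
        have : (fun z : ℕ × (ℕ → E) => t (z.2 (if i' = i then j else j'))) ⁻¹' {c} =
            Prod.snd ⁻¹' ((fun ξ : ℕ → E => ξ (if i' = i then j else j')) ⁻¹' (t ⁻¹' {c})) := rfl
        rw [this]
        refine Measure.quasiMeasurePreserving_snd.preimage_null ?_
        rw [← Measure.map_apply (measurable_pi_apply _) hS, Measure.infinitePi_map_eval, hpt]
    filter_upwards [h1] with ω hω _
    simpa [point, Ne.symm hi] using hω

end PoissonProcess

namespace ClosedSubgroup

open scoped ENNReal NNReal
open TopologicalSpace EffrosSpace ProbabilityTheory PoissonProcess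

/-! ### Closed sets with a prescribed stabilizer -/

section IsStab

variable {G E : Type*} [Group G] [TopologicalSpace G] [TopologicalSpace E] [MulAction G E]

/-- `H` consists of the elements that map `F` into itself. -/
def IsStab (H : ClosedSubgroup G) (F : EffrosSpace E) : Prop :=
  (∀ h ∈ H, ∀ x ∈ F, h • x ∈ F) ∧ ∀ g : G, (∀ x ∈ F, g • x ∈ F) → g ∈ H

variable [ContinuousSMul G E] [SecondCountableTopology G] [SecondCountableTopology E]

theorem exists_basis_smul {g : G} {x : E} {U : Set E} (hU : IsOpen U) (h : g • x ∈ U) :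
    ∃ (V : countableBasis G) (W : countableBasis E), g ∈ (V : Set G) ∧ x ∈ (W : Set E) ∧
      ∀ g' ∈ (V : Set G), ∀ x' ∈ (W : Set E), g' • x' ∈ U := by
  have hopen : IsOpen {p : G × E | p.1 • p.2 ∈ U} := hU.preimage continuous_smul
  obtain ⟨A, B, hA, hB, hgA, hxB, hAB⟩ := isOpen_prod_iff.1 hopen g x h
  obtain ⟨V, hgV, hVA⟩ := exists_basis hA hgA
  obtain ⟨W, hxW, hWB⟩ := exists_basis hB hxB
  exact ⟨V, W, hgV, hxW, fun g' hg' x' hx' => hAB (Set.mk_mem_prod (hVA hg') (hWB hx'))⟩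

/-- Triples of basic open sets with `V • W ⊆ U`. -/
def Triple (G E : Type*) [Group G] [TopologicalSpace G] [TopologicalSpace E] [MulAction G E]
    [SecondCountableTopology G] [SecondCountableTopology E] :=
  {q : countableBasis G × countableBasis E × countableBasis E //
    ∀ g ∈ (q.1 : Set G), ∀ x ∈ (q.2.1 : Set E), g • x ∈ (q.2.2 : Set E)}

instance : Countable (Triple G E) := by
  unfold Triple
  infer_instance

/-- A failure g x ∉ F with F closed persists for nearby g and x, so it is witnessed by a triple of
basic sets; invariance becomes a countable condition. -/
theorem forall_smul_mem_iff (H : ClosedSubgroup G) (F : EffrosSpace E) :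
    (∀ h ∈ H, ∀ x ∈ F, h • x ∈ F) ↔ ∀ q : Triple G E, H.toEffros ∈ hit (q.1.1 : Set G) →
      F ∈ hit (q.1.2.1 : Set E) → F ∈ hit (q.1.2.2 : Set E) := by
  constructor
  · rintro hF q ⟨h, hh, hhV⟩ ⟨x, hx, hxW⟩
    exact ⟨h • x, hF h hh x hx, q.2 h hhV x hxW⟩
  · intro hq h hh x hx
    by_contra hhx
    obtain ⟨U, hxU, hUF⟩ := exists_basis F.isClosed.isOpen_compl hhx
    obtain ⟨V, W, hhV, hxW, hVW⟩ := exists_basis_smul (isOpen_basis U) hxU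
    obtain ⟨y, hy, hyU⟩ := hq ⟨(V, W, U), hVW⟩ ⟨h, hh, hhV⟩ ⟨x, hx, hxW⟩
    exact hUF hyU hy

/-- Failing to map F into itself is an open condition on g, witnessed by a triple; compactness
leaves finitely many triples, hence a countable union of Borel conditions on F. -/
theorem forall_not_smul_mem_iff {C : Set G} (hC : IsCompact C) (F : EffrosSpace E) :
    (∀ g ∈ C, ¬ ∀ x ∈ F, g • x ∈ F) ↔ ∃ s : Finset (Triple G E),
      C ⊆ (⋃ q ∈ s, (q.1.1 : Set G)) ∧
        ∀ q ∈ s, F ∈ hit (q.1.2.1 : Set E) ∧ F ∉ hit (q.1.2.2 : Set E) := by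
  constructor
  · intro h
    have hex : ∀ g ∈ C, ∃ q : Triple G E, g ∈ (q.1.1 : Set G) ∧
        (F ∈ hit (q.1.2.1 : Set E) ∧ F ∉ hit (q.1.2.2 : Set E)) := by
      intro g hg
      have := h g hg
      push Not at this
      obtain ⟨x, hx, hgx⟩ := this
      obtain ⟨U, hxU, hUF⟩ := exists_basis F.isClosed.isOpen_compl hgx
      obtain ⟨V, W, hgV, hxW, hVW⟩ := exists_basis_smul (isOpen_basis U) hxU
      exact ⟨⟨(V, W, U), hVW⟩, hgV, ⟨x, hx, hxW⟩, fun ⟨y, hy, hyU⟩ => hUF hyU hy⟩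
    rcases C.eq_empty_or_nonempty with rfl | ⟨g₀, hg₀⟩
    · exact ⟨∅, by simp, by simp⟩
    have : Nonempty (Triple G E) := ⟨(hex g₀ hg₀).choose⟩
    choose! T hgT hT using hex
    obtain ⟨t, ht, hts⟩ := hC.elim_nhds_subcover (fun g => ((T g).1.1 : Set G)) fun g hg =>
      (isOpen_basis _).mem_nhds (hgT g hg)
    classical
    refine ⟨t.image T, by simpa using hts, fun q hq => ?_⟩
    obtain ⟨g, hg, rfl⟩ := Finset.mem_image.1 hq
    exact hT g (ht g hg)
  · rintro ⟨s, hCs, hs⟩ g hg hgF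
    obtain ⟨q, hq, hgq⟩ := Set.mem_iUnion₂.1 (hCs hg)
    obtain ⟨⟨x, hx, hxW⟩, hU⟩ := hs q hq
    exact hU ⟨g • x, hgF x hx, q.2 g hgq x hxW⟩

variable [LocallyCompactSpace G] [T2Space G]

/-- Each element outside H has a basic neighbourhood with compact closure disjoint from H, which
reduces the uncountable quantifier over g to countably many compact sets. -/
theorem forall_mem_iff (H : ClosedSubgroup G) (F : EffrosSpace E) :
    (∀ g : G, (∀ x ∈ F, g • x ∈ F) → g ∈ H) ↔
      ∀ W : {W : countableBasis G // IsCompact (closure (W : Set G))},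
        (H : Set G) ∩ closure (W.1 : Set G) = ∅ →
          ∀ g ∈ closure (W.1 : Set G), ¬ ∀ x ∈ F, g • x ∈ F := by
  constructor
  · intro h W hW g hg hgF
    exact Set.eq_empty_iff_forall_notMem.1 hW g ⟨h g hgF, hg⟩
  · intro h g hgF
    by_contra hgH
    obtain ⟨W, hgW, hWc, hWH⟩ := exists_basis_compact H.isClosed'.isOpen_compl hgH
    refine h ⟨W, hWc⟩ ?_ g (subset_closure hgW) hgF
    exact Set.disjoint_iff_inter_eq_empty.1 (Set.disjoint_left.2 fun x hx hxW => hWH hxW hx)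

theorem measurableSet_isStab :
    MeasurableSet {p : ClosedSubgroup G × EffrosSpace E | IsStab p.1 p.2} := by
  have hF : ∀ {U : Set E}, IsOpen U →
      Measurable fun p : ClosedSubgroup G × EffrosSpace E => p.2 ∈ hit U := fun hU =>
    measurableSet_setOfPred.1 (measurable_snd (measurableSet_hit hU))
  have hH : ∀ {U : Set G}, IsOpen U →
      Measurable fun p : ClosedSubgroup G × EffrosSpace E => p.1.toEffros ∈ hit U := fun hU =>
    measurableSet_setOfPred.1 ((measurable_toEffros.comp measurable_fst) (measurableSet_hit hU))
  refine measurableSet_setOfPred.2 (Measurable.and ?_ ?_)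
  · simp_rw [forall_smul_mem_iff]
    exact Measurable.forall fun q => (hH (isOpen_basis _)).imp
      ((hF (isOpen_basis _)).imp (hF (isOpen_basis _)))
  · simp_rw [forall_mem_iff]
    refine Measurable.forall fun W => Measurable.imp ?_ ?_
    · exact measurableSet_setOfPred.1 (measurable_fst (isOpen_miss W.2).measurableSet)
    · simp_rw [forall_not_smul_mem_iff W.2]
      exact Measurable.exists fun s => measurable_const.and (Measurable.forall fun q =>
        measurable_const.imp ((hF (isOpen_basis _)).and (hF (isOpen_basis _)).not))

end IsStab

/-! ### The Poisson process of labelled cosets -/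

/-- Elements of `G` with a real label. -/
def Labelled (G : Type*) := G × ℝ

namespace Labelled

variable {G : Type*} [Group G] [TopologicalSpace G]

instance : TopologicalSpace (Labelled G) := inferInstanceAs (TopologicalSpace (G × ℝ))
instance [T2Space G] : T2Space (Labelled G) := inferInstanceAs (T2Space (G × ℝ))
instance [LocallyCompactSpace G] : LocallyCompactSpace (Labelled G) :=
  inferInstanceAs (LocallyCompactSpace (G × ℝ))
instance [SecondCountableTopology G] : SecondCountableTopology (Labelled G) :=
  inferInstanceAs (SecondCountableTopology (G × ℝ))
instance [MeasurableSpace G] : MeasurableSpace (Labelled G) :=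
  inferInstanceAs (MeasurableSpace (G × ℝ))
instance [MeasurableSpace G] [BorelSpace G] [SecondCountableTopology G] : BorelSpace (Labelled G) :=
  inferInstanceAs (BorelSpace (G × ℝ))

/-- `G` acts by left multiplication and preserves the labels. -/
instance : MulAction G (Labelled G) where
  smul g x := (g * x.1, x.2)
  one_smul _ := Prod.ext (one_mul _) rfl
  mul_smul _ _ _ := Prod.ext (mul_assoc _ _ _) rfl

/-- The element `y` with label `t`. -/
def mk (y : G) (t : ℝ) : Labelled G := (y, t)

theorem smul_mk (g y : G) (t : ℝ) : g • mk y t = mk (g * y) t := rfl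

theorem smul_fst (g : G) (x : Labelled G) : (g • x).1 = g * x.1 := rfl

theorem smul_snd (g : G) (x : Labelled G) : (g • x).2 = x.2 := rfl

instance [IsTopologicalGroup G] : ContinuousSMul G (Labelled G) where
  continuous_smul := by
    have : Continuous fun p : G × (G × ℝ) => ((p.1 * p.2.1, p.2.2) : G × ℝ) := by fun_prop
    exact this

end Labelled

variable {G : Type*} [Group G] [TopologicalSpace G] [IsTopologicalGroup G] [T2Space G]
  [LocallyCompactSpace G] [SecondCountableTopology G] [MeasurableSpace G] [BorelSpace G]

/-- The intensity of the process of labelled cosets. -/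
noncomputable def intensity (H : ClosedSubgroup G) : Measure (Labelled G) :=
  (H.transverse.prod volume : Measure (G × ℝ))

instance (H : ClosedSubgroup G) : SigmaFinite H.intensity :=
  inferInstanceAs (SigmaFinite (H.transverse.prod volume))

/-- The infinite length of the label line ensures that the process almost surely has a point. -/
theorem intensity_univ (H : ClosedSubgroup G) : H.intensity Set.univ = ∞ := by
  have : (Set.univ : Set (G × ℝ)) = Set.univ ×ˢ Set.univ := Set.univ_prod_univ.symm
  change (H.transverse.prod volume) (Set.univ : Set (G × ℝ)) = ∞
  rw [this, Measure.prod_prod, Real.volume_univ, ENNReal.mul_top H.transverse_ne_zero]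

instance (H : ClosedSubgroup G) : NeZero H.intensity := ⟨fun h => by
  have := H.intensity_univ
  simp [h] at this⟩

theorem intensity_label (H : ClosedSubgroup G) (c : ℝ) :
    H.intensity ((fun x : Labelled G => x.2) ⁻¹' {c}) = 0 := by
  have : ((fun x : G × ℝ => x.2) ⁻¹' {c}) = Set.univ ×ˢ {c} := by
    ext x
    simp
  change (H.transverse.prod volume) ((fun x : G × ℝ => x.2) ⁻¹' {c}) = 0
  rw [this, Measure.prod_prod, Real.volume_singleton, mul_zero]

theorem intensity_apply (H : ClosedSubgroup G) {S : Set (Labelled G)} (hS : MeasurableSet S) :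
    H.intensity S = ∫⁻ t : ℝ, H.transverse {y | Labelled.mk y t ∈ S} :=
  Measure.prod_apply_symm (μ := H.transverse) (ν := (volume : Measure ℝ)) (s := S) hS

theorem measurableSet_slice {S : Set (Labelled G)} (hS : MeasurableSet S) (t : ℝ) :
    MeasurableSet {y : G | Labelled.mk y t ∈ S} :=
  (measurable_prodMk_right : Measurable fun y : G => ((y, t) : G × ℝ)) hS

theorem measurable_intensity_saturation {U : Set (Labelled G)} (hU : IsOpen U) :
    Measurable fun H : ClosedSubgroup G => H.intensity (H.saturation U) := by
  obtain ⟨β, hβ, hβH⟩ := exists_measurable_transverseDensity (G := G)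
  have hS := measurableSet_saturation (G := G) hU
  have h1 : ∀ H : ClosedSubgroup G, H.intensity (H.saturation U) =
      ∫⁻ t : ℝ, ∫⁻ y, {p : ClosedSubgroup G × Labelled G | p.2 ∈ p.1.saturation U}.indicator
        (fun p => β (p.1, p.2.1)) (H, Labelled.mk y t) ∂Measure.haar := by
    intro H
    have hSH : MeasurableSet (H.saturation U) := (H.isOpen_saturation hU).measurableSet
    rw [H.intensity_apply hSH]
    refine lintegral_congr fun t => ?_
    -- For each fixed H the density may be replaced by the jointly measurable version β, after which
    -- Fubini gives measurability in H.
    rw [transverse, withDensity_congr_ae (hβH H), withDensity_apply _ (measurableSet_slice hSH t),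
      ← lintegral_indicator (measurableSet_slice hSH t)]
    rfl
  simp_rw [h1]
  have hm : Measurable fun q : (ClosedSubgroup G × ℝ) × G =>
      {p : ClosedSubgroup G × Labelled G | p.2 ∈ p.1.saturation U}.indicator
        (fun p => β (p.1, p.2.1)) (q.1.1, ((q.2, q.1.2) : Labelled G)) := by
    have hβ' : Measurable fun p : ClosedSubgroup G × Labelled G => β (p.1, p.2.1) :=
      hβ.comp (measurable_fst.prodMk
        ((measurable_fst : Measurable (Prod.fst : G × ℝ → G)).comp measurable_snd))
    have hpair : Measurable fun q : (ClosedSubgroup G × ℝ) × G =>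
        (((q.2, q.1.2) : G × ℝ) : Labelled G) :=
      measurable_snd.prodMk measurable_fst.snd
    exact (hβ'.indicator hS).comp (measurable_fst.fst.prodMk hpair)
  exact (hm.lintegral_prod_right' (ν := Measure.haar)).lintegral_prod_right' (ν := volume)

/-- At each fixed label, the slice of the saturation is invariant under gHg⁻¹, so `transverse_smul`
applies slice by slice. -/
theorem intensity_smul (g : G) (H : ClosedSubgroup G) {U : Set (Labelled G)} (hU : IsOpen U) :
    (g • H).intensity ((g • H).saturation U) =
      H.intensity (H.saturation ((fun x => g • x) ⁻¹' U)) := by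
  have hU' : IsOpen ((fun x : Labelled G => g • x) ⁻¹' U) := hU.preimage (continuous_const_smul g)
  have hS := ((g • H).isOpen_saturation hU).measurableSet
  rw [intensity_apply _ hS, intensity_apply _ (H.isOpen_saturation hU').measurableSet]
  refine lintegral_congr fun t => ?_
  rw [transverse_smul g H (measurableSet_slice hS t)]
  · congr 1
    ext y
    have hgh (h : G) : (g * h * g⁻¹) • Labelled.mk (g * y) t = g • h • Labelled.mk y t := by
      simp [Labelled.smul_mk, mul_assoc]
    constructor
    · rintro ⟨_, ⟨h, hh, rfl⟩, hy⟩
      refine ⟨h, hh, Set.mem_preimage.2 ?_⟩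
      rwa [← hgh]
    · rintro ⟨h, hh, hy⟩
      refine ⟨g * h * g⁻¹, ⟨h, hh, rfl⟩, ?_⟩
      rw [hgh]
      exact hy
  · intro h hh y
    exact (g • H).smul_mem_saturation (U := U) hh (Labelled.mk y t)

/-- H does not move labels, so the saturation of U lies in the product of the saturation of a
relatively compact set and a compact set of labels. -/
theorem intensity_lt_top (H : ClosedSubgroup G) {U : Set (Labelled G)}
    (hUc : IsCompact (closure U)) : H.intensity (H.saturation U) < ∞ := by
  have hK1 : IsCompact ((fun x : G × ℝ => x.1) '' closure U) := IsCompact.image hUc continuous_fst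
  have hK2 : IsCompact ((fun x : G × ℝ => x.2) '' closure U) := IsCompact.image hUc continuous_snd
  obtain ⟨V, hV, hKV, hVc⟩ := exists_isOpen_superset_and_isCompact_closure hK1
  have hA : IsOpen (H.saturation V) := H.isOpen_saturation hV
  have hfin : H.transverse (H.saturation V) < ∞ :=
    H.transverse_lt_top hVc hA.measurableSet (fun h hh y => H.smul_mem_saturation hh y)
      fun y ⟨h, hh, hy⟩ => ⟨h, hh, subset_closure hy⟩
  let S : Set (Labelled G) := H.saturation V ×ˢ ((fun x : G × ℝ => x.2) '' closure U)
  have hsub : H.saturation U ⊆ S := by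
    rintro x ⟨h, hh, hx⟩
    exact ⟨⟨h, hh, hKV ⟨_, subset_closure hx, rfl⟩⟩, ⟨_, subset_closure hx, rfl⟩⟩
  refine (measure_mono hsub).trans_lt ?_
  change (H.transverse.prod volume) (H.saturation V ×ˢ ((fun x : G × ℝ => x.2) '' closure U)) < ∞
  rw [Measure.prod_prod]
  exact ENNReal.mul_lt_top hfin hK2.measure_lt_top

/-- The closed set formed by the labelled cosets of the points of the process. -/
noncomputable def cosets (H : ClosedSubgroup G) (ω : Sample (Labelled G)) :
    EffrosSpace (Labelled G) :=
  ofClosure {x | ∃ q ∈ active ω, ∃ h ∈ H, x = h • point ω q}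

theorem cosets_notMem_hit_iff (H : ClosedSubgroup G) (ω : Sample (Labelled G))
    {U : Set (Labelled G)} (hU : IsOpen U) :
    H.cosets ω ∈ (hit U)ᶜ ↔ ∀ q ∈ active ω, point ω q ∉ H.saturation U := by
  rw [Set.mem_compl_iff, mem_hit, cosets, ofClosure_inter_nonempty hU]
  constructor
  · rintro h q hq ⟨k, hk, hx⟩
    exact h ⟨_, ⟨q, hq, k, hk, rfl⟩, hx⟩
  · rintro h ⟨_, ⟨q, hq, k, hk, rfl⟩, hx⟩
    exact h q hq ⟨k, hk, hx⟩

theorem measurable_cosets (H : ClosedSubgroup G) : Measurable H.cosets := by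
  refine measurable_of_hit fun U hU => ?_
  have hS := (H.isOpen_saturation hU).measurableSet
  have : {ω | ((H.cosets ω : Set (Labelled G)) ∩ U).Nonempty} =
      ⋃ q : ℕ × ℕ, {ω | q ∈ active ω} ∩ (fun ω => point ω q) ⁻¹' H.saturation U := by
    ext ω
    have := not_congr (H.cosets_notMem_hit_iff ω hU)
    rw [Set.mem_compl_iff, not_not] at this
    rw [Set.mem_ofPred_eq, ← mem_hit, this]
    simp
  rw [this]
  exact MeasurableSet.iUnion fun q => (measurableSet_active q).inter (measurable_point q hS)

theorem isClosed_orbit (H : ClosedSubgroup G) (x : Labelled G) :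
    IsClosed {z : Labelled G | ∃ h ∈ H, z = h • x} := by
  have : {z : Labelled G | ∃ h ∈ H, z = h • x} =
      (fun z : G × ℝ => (z.1 * x.1⁻¹, z.2)) ⁻¹' ((H : Set G) ×ˢ {x.2}) := by
    ext z
    constructor
    · rintro ⟨h, hh, rfl⟩
      exact ⟨by simpa [Labelled.smul_fst] using hh, rfl⟩
    · rintro ⟨hz, hz2⟩
      exact ⟨_, hz, Prod.ext (by simp [Labelled.smul_fst]) hz2⟩
  rw [this]
  have hc : Continuous fun z : G × ℝ => (z.1 * x.1⁻¹, z.2) := by fun_prop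
  exact (H.isClosed'.prod isClosed_singleton).preimage hc

/-- Local finiteness makes the closure superfluous: only finitely many orbits meet a relatively
compact neighbourhood of x, and each orbit is closed. -/
theorem mem_cosets_iff (H : ClosedSubgroup G) {ω : Sample (Labelled G)}
    (hfin : ∀ U : countableBasis (Labelled G), IsCompact (closure (U : Set (Labelled G))) →
      {q | q ∈ active ω ∧ point ω q ∈ H.saturation (U : Set (Labelled G))}.Finite)
    (x : Labelled G) : x ∈ H.cosets ω ↔ ∃ q ∈ active ω, ∃ h ∈ H, x = h • point ω q := by
  refine ⟨fun hx => ?_, fun hx => subset_closure hx⟩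
  obtain ⟨U, hxU, hUc, -⟩ := exists_basis_compact isOpen_univ (Set.mem_univ x)
  by_contra hne
  push Not at hne
  set S := {q | q ∈ active ω ∧ point ω q ∈ H.saturation (U : Set (Labelled G))} with hS
  have hO : IsOpen ((U : Set (Labelled G)) ∩ ⋂ q ∈ S, {z | ∃ h ∈ H, z = h • point ω q}ᶜ) :=
    (isOpen_basis U).inter ((hfin U hUc).isOpen_biInter fun q _ =>
      (H.isClosed_orbit _).isOpen_compl)
  have hxO : x ∈ (U : Set (Labelled G)) ∩ ⋂ q ∈ S, {z | ∃ h ∈ H, z = h • point ω q}ᶜ := by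
    refine ⟨hxU, Set.mem_iInter₂.2 fun q hq => ?_⟩
    rintro ⟨h, hh, hxh⟩
    exact hne q hq.1 h hh hxh
  obtain ⟨z, hzO, q, hq, h, hh, rfl⟩ := mem_closure_iff.1 hx _ hO hxO
  exact Set.mem_iInter₂.1 hzO.2 q ⟨hq, h, hh, hzO.1⟩ ⟨h, hh, rfl⟩

/-- An element g mapping the set into itself sends a point y with label t to a point of the set with
the same label. Labels being distinct, this lies in the same coset, so gy = hy with h in H and g =
h. -/
theorem isStab_cosets (H : ClosedSubgroup G) {ω : Sample (Labelled G)}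
    (hfin : ∀ U : countableBasis (Labelled G), IsCompact (closure (U : Set (Labelled G))) →
      {q | q ∈ active ω ∧ point ω q ∈ H.saturation (U : Set (Labelled G))}.Finite)
    (hlabel : ∀ q q' : ℕ × ℕ, q ≠ q' → (point ω q).2 ≠ (point ω q').2)
    (hne : ∃ q, q ∈ active ω) : IsStab H (H.cosets ω) := by
  refine ⟨fun h hh x hx => ?_, fun g hg => ?_⟩
  · rw [H.mem_cosets_iff hfin] at hx ⊢
    obtain ⟨q, hq, k, hk, rfl⟩ := hx
    exact ⟨q, hq, h * k, mul_mem hh hk, (mul_smul h k _).symm⟩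
  · obtain ⟨q, hq⟩ := hne
    have hmem := hg (point ω q) ((H.mem_cosets_iff hfin _).2 ⟨q, hq, 1, one_mem H, by simp⟩)
    obtain ⟨q', hq', h, hh, hgh⟩ := (H.mem_cosets_iff hfin _).1 hmem
    have hqq' : q = q' := by
      by_contra hne
      refine hlabel q q' hne ?_
      have := congrArg (fun x : Labelled G => x.2) hgh
      simpa [Labelled.smul_snd] using this
    subst hqq'
    have := congrArg (fun x : Labelled G => x.1) hgh
    simp only [Labelled.smul_fst, mul_left_inj] at this
    rwa [this]

theorem exists_poisson_law (H : ClosedSubgroup G) :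
    ∃ μ : Measure (EffrosSpace (Labelled G)), IsProbabilityMeasure μ ∧
      (∀ U : Set (Labelled G), IsOpen U → μ (hit U)ᶜ = void (H.intensity (H.saturation U))) ∧
      ∀ᵐ F ∂μ, IsStab H F := by
  obtain ⟨r, p, hp, hac, hsum⟩ := exists_sum_probability H.intensity
  refine ⟨(law r p).map H.cosets, Measure.isProbabilityMeasure_map H.measurable_cosets.aemeasurable,
    fun U hU => ?_, ?_⟩
  · rw [Measure.map_apply H.measurable_cosets (measurableSet_hit hU).compl, hsum,
      ← law_void r p (H.isOpen_saturation hU).measurableSet]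
    congr 1
    ext ω
    exact H.cosets_notMem_hit_iff ω hU
  · have hmeas : MeasurableSet {F : EffrosSpace (Labelled G) | IsStab H F} :=
      measurable_prodMk_left measurableSet_isStab
    rw [ae_map_iff H.measurable_cosets.aemeasurable hmeas]
    have hfin : ∀ᵐ ω ∂law r p, ∀ U : countableBasis (Labelled G),
        IsCompact (closure (U : Set (Labelled G))) →
          {q | q ∈ active ω ∧ point ω q ∈ H.saturation (U : Set (Labelled G))}.Finite := by
      rw [ae_all_iff]
      intro U
      by_cases hU : IsCompact (closure (U : Set (Labelled G)))
      · have := law_finite r p (H.isOpen_saturation (isOpen_basis U)).measurableSet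
          (by rw [← hsum]; exact (H.intensity_lt_top hU).ne)
        filter_upwards [this] with ω hω _ using hω
      · exact Eventually.of_forall fun _ h => absurd h hU
    have hlabel := law_injective r p (t := fun x : Labelled G => x.2)
      (measurable_snd : Measurable (Prod.snd : G × ℝ → ℝ))
      (by rw [← hsum]; exact H.intensity_label) (by rw [← hsum]; exact hac)
    have hne : ∀ᵐ ω ∂law r p, ∃ q, q ∈ active ω := by
      -- The process is empty with probability `void` ∞ = 0.
      have h0 := law_void r p (MeasurableSet.univ (α := Labelled G))
      rw [← hsum, H.intensity_univ, void_top] at h0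
      rw [ae_iff]
      convert! h0 using 2
      simp
    filter_upwards [hfin, hlabel, hne] with ω h1 h2 h3
    exact H.isStab_cosets h1 h2 h3

/-- The law of the Poisson process of labelled cosets of `H`. -/
noncomputable def poissonLaw (H : ClosedSubgroup G) : Measure (EffrosSpace (Labelled G)) :=
  H.exists_poisson_law.choose

instance (H : ClosedSubgroup G) : IsProbabilityMeasure H.poissonLaw :=
  H.exists_poisson_law.choose_spec.1

theorem poissonLaw_void (H : ClosedSubgroup G) {U : Set (Labelled G)} (hU : IsOpen U) :
    H.poissonLaw (hit U)ᶜ = void (H.intensity (H.saturation U)) :=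
  H.exists_poisson_law.choose_spec.2.1 U hU

theorem ae_isStab_poissonLaw (H : ClosedSubgroup G) : ∀ᵐ F ∂H.poissonLaw, IsStab H F :=
  H.exists_poisson_law.choose_spec.2.2

/-- Although the law comes from a choice, its void probabilities are prescribed by the equivariant
intensity, and they determine it. -/
theorem poissonLaw_smul (g : G) (H : ClosedSubgroup G) :
    (g • H).poissonLaw = H.poissonLaw.map (g • ·) := by
  have hm : Measurable fun F : EffrosSpace (Labelled G) => g • F := measurable_const_smul g
  have := Measure.isProbabilityMeasure_map (μ := H.poissonLaw) hm.aemeasurable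
  refine ext_of_void fun U hU => ?_
  have hpre : (fun F : EffrosSpace (Labelled G) => g • F) ⁻¹' (hit U)ᶜ =
      (hit ((fun x => g • x) ⁻¹' U))ᶜ := by
    ext F
    exact not_congr smul_inter_nonempty
  rw [Measure.map_apply hm (measurableSet_hit hU).compl, hpre, poissonLaw_void _ hU,
    poissonLaw_void _ (hU.preimage (continuous_const_smul g)), intensity_smul g H hU]

theorem measurable_poissonLaw :
    Measurable (poissonLaw : ClosedSubgroup G → Measure (EffrosSpace (Labelled G))) := by
  refine Measurable.measure_of_isPiSystem_of_isProbabilityMeasure generateFrom_compl_hit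
    isPiSystem_compl_hit ?_
  rintro _ ⟨U, hU, rfl⟩
  simp_rw [poissonLaw_void _ hU]
  exact continuous_void.measurable.comp (measurable_intensity_saturation hU)

end ClosedSubgroup

open scoped ENNReal
open ProbabilityTheory

instance Prod.measurableSMul₂ {G X Z : Type*} [MeasurableSpace G] [MeasurableSpace X]
    [MeasurableSpace Z] [SMul G X] [SMul G Z] [MeasurableSMul₂ G X] [MeasurableSMul₂ G Z] :
    MeasurableSMul₂ G (X × Z) where
  measurable_smul :=
    (measurable_fst.smul measurable_snd.fst).prodMk (measurable_fst.smul measurable_snd.snd)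

/-! ### Skew products -/

section SkewProduct

variable {X Z : Type*} [MeasurableSpace X] [MeasurableSpace Z]

theorem barycenter_map_apply {ν : Measure X} {D : X → ProbabilityMeasure Z} (hD : Measurable D)
    {s : Set Z} (hs : MeasurableSet s) :
    barycenter (ν.map D) s = ∫⁻ x, (D x : Measure Z) s ∂ν := by
  have hc : Measurable fun μ : ProbabilityMeasure Z => (μ : Measure Z) := measurable_subtype_coe
  rw [barycenter, Measure.map_map hc hD, Measure.join_apply hs,
    lintegral_map (Measure.measurable_coe hs) (hc.comp hD)]
  rfl

theorem ae_barycenter_map {ν : Measure X} {D : X → ProbabilityMeasure Z} (hD : Measurable D)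
    {p : Z → Prop} (hp : MeasurableSet {z | p z})
    (h : ∀ᵐ x ∂ν, ∀ᵐ z ∂(D x : Measure Z), p z) : ∀ᵐ z ∂barycenter (ν.map D), p z := by
  refine (barycenter_map_apply hD hp.compl).trans ?_
  exact (lintegral_congr_ae h).trans lintegral_zero

theorem map_barycenter_map {W : Type*} [MeasurableSpace W] {ν : Measure X}
    {D : X → ProbabilityMeasure Z} {D' : X → ProbabilityMeasure W} (hD : Measurable D)
    (hD' : Measurable D') {f : Z → W} (hf : Measurable f)
    (h : ∀ x, (D x : Measure Z).map f = D' x) :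
    (barycenter (ν.map D)).map f = barycenter (ν.map D') := by
  ext s hs
  rw [Measure.map_apply hf hs, barycenter_map_apply hD (hf hs), barycenter_map_apply hD' hs]
  refine lintegral_congr fun x => ?_
  rw [← h, Measure.map_apply hf hs]

theorem measurable_probabilityMeasure {D : X → ProbabilityMeasure Z}
    (h : ∀ s, MeasurableSet s → Measurable fun x => (D x : Measure Z) s) : Measurable D :=
  (Measure.measurable_of_measurable_coe _ h).subtype_mk

/-- The product of the point mass at `x` with `κ x`. -/
noncomputable def skew (κ : X → ProbabilityMeasure Z) (x : X) : ProbabilityMeasure (X × Z) :=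
  ⟨(Measure.dirac x).prod (κ x), inferInstance⟩

theorem coe_skew (κ : X → ProbabilityMeasure Z) (x : X) :
    (skew κ x : Measure (X × Z)) = (κ x : Measure Z).map (Prod.mk x) :=
  Measure.dirac_prod x

theorem measurable_skew {κ : X → ProbabilityMeasure Z} (hκ : Measurable κ) :
    Measurable (skew κ) := by
  let k : Kernel X Z := ⟨fun x => κ x, measurable_subtype_coe.comp hκ⟩
  have : IsMarkovKernel k := ⟨fun x => inferInstanceAs (IsProbabilityMeasure (κ x : Measure Z))⟩
  refine measurable_probabilityMeasure fun s hs => ?_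
  have h : ∀ x, (skew κ x : Measure (X × Z)) s = k x (Prod.mk x ⁻¹' s) := fun x => by
    rw [coe_skew, Measure.map_apply measurable_prodMk_left hs]
    rfl
  simp_rw [h]
  exact Kernel.measurable_kernel_prodMk_left hs

theorem map_fst_skew (κ : X → ProbabilityMeasure Z) (x : X) :
    (skew κ x : Measure (X × Z)).map Prod.fst = Measure.dirac x := by
  change ((Measure.dirac x).prod (κ x : Measure Z)).map Prod.fst = _
  simp

theorem map_snd_skew (κ : X → ProbabilityMeasure Z) (x : X) :
    (skew κ x : Measure (X × Z)).map Prod.snd = κ x := by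
  change ((Measure.dirac x).prod (κ x : Measure Z)).map Prod.snd = _
  simp

theorem isDisintegration_skew [MeasurableSingletonClass X] (ν : Measure X)
    {κ : X → ProbabilityMeasure Z} (hκ : Measurable κ) :
    IsDisintegration (barycenter (ν.map (skew κ))) ν Prod.fst (skew κ) where
  measurable := measurable_skew hκ
  fiber := Eventually.of_forall fun x => by
    rw [← Measure.map_apply measurable_fst (measurableSet_singleton x), map_fst_skew]
    simp
  integral := rfl

variable {G : Type*} [Group G] [MeasurableSpace G] [MulAction G X] [MulAction G Z]
  [MeasurableSMul₂ G X] [MeasurableSMul₂ G Z]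

theorem coe_translate (g : G) (μ : ProbabilityMeasure X) :
    ((g • μ : ProbabilityMeasure X) : Measure X) = (μ : Measure X).map (g • ·) := rfl

theorem isEquivariant_skew {ν : Measure X} {κ : X → ProbabilityMeasure Z}
    (hκ : IsEquivariant G ν κ) : IsEquivariant G ν (skew κ) := by
  intro g
  filter_upwards [hκ g] with x hx
  have h : (skew κ (g • x) : Measure (X × Z)) = (skew κ x : Measure (X × Z)).map (g • ·) := by
    rw [coe_skew, coe_skew, hx, coe_translate, Measure.map_map measurable_prodMk_left
      (measurable_const_smul g), Measure.map_map (measurable_const_smul g) measurable_prodMk_left]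
    rfl
  exact Subtype.ext h

theorem isProbabilityMeasure_barycenter_map {ν : Measure X} [IsProbabilityMeasure ν]
    {D : X → ProbabilityMeasure Z} (hD : Measurable D) :
    IsProbabilityMeasure (barycenter (ν.map D)) := ⟨by
  rw [barycenter_map_apply hD MeasurableSet.univ]
  simp⟩

theorem IsQuasiInvariant.ae_smul {ν : Measure X} (hν : IsQuasiInvariant G ν) (g : G)
    {p : X → Prop} (hp : MeasurableSet {x | p x}) :
    (∀ᵐ x ∂ν, p (g • x)) ↔ ∀ᵐ x ∂ν, p x :=
  hν.null_iff g _ hp.compl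

/-- A set is null for the barycenter exactly when almost every fibre measure ignores it.
Equivariance turns the fibre mass of g⁻¹E at x into that of E at gx, and quasi-invariance of ν
removes the translation. -/
theorem IsQuasiInvariant.barycenter_map {ν : Measure X} (hν : IsQuasiInvariant G ν)
    {D : X → ProbabilityMeasure Z} (hD : Measurable D) (hDe : IsEquivariant G ν D) :
    IsQuasiInvariant G (barycenter (ν.map D)) where
  isProbabilityMeasure := by
    have := hν.isProbabilityMeasure
    exact isProbabilityMeasure_barycenter_map hD
  null_iff g E hE := by
    have hg : Measurable fun z : Z => g • z := measurable_const_smul g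
    have hDE : Measurable fun x => (D x : Measure Z) E :=
      (Measure.measurable_coe hE).comp (measurable_subtype_coe.comp hD)
    have hDgE : Measurable fun x => (D x : Measure Z) ((g • ·) ⁻¹' E) :=
      (Measure.measurable_coe (hg hE)).comp (measurable_subtype_coe.comp hD)
    rw [barycenter_map_apply hD hE, barycenter_map_apply hD (hg hE), lintegral_eq_zero_iff hDE,
      lintegral_eq_zero_iff hDgE]
    refine Iff.trans ?_ (hν.ae_smul g (p := fun x => (D x : Measure Z) E = 0)
      (hDE (measurableSet_singleton 0)))
    refine eventually_congr ?_
    filter_upwards [hDe g] with x hx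
    rw [hx, coe_translate, Measure.map_apply hg hE]
    rfl

theorem isGMap_skew {ν : Measure X} {κ : X → ProbabilityMeasure Z} (hκ : Measurable κ) :
    IsGMap G (barycenter (ν.map (skew κ))) ν Prod.fst where
  measurable := measurable_fst
  map_eq := by
    ext s hs
    rw [Measure.map_apply measurable_fst hs,
      barycenter_map_apply (measurable_skew hκ) (measurable_fst hs)]
    simp_rw [← Measure.map_apply measurable_fst hs, map_fst_skew, Measure.dirac_apply' _ hs]
    exact lintegral_indicator_one hs
  equivariant _ := Eventually.of_forall fun _ => rfl

end SkewProduct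

namespace ClosedSubgroup

variable {G : Type*} [Group G] [TopologicalSpace G] [IsTopologicalGroup G] [T2Space G]
  [LocallyCompactSpace G] [SecondCountableTopology G] [MeasurableSpace G] [BorelSpace G]

/-! ### The subgroups of the stabilizers -/

section Stab

variable {X : Type*} [MeasurableSpace X] [StandardBorelSpace X] [MulAction G X]
  [MeasurableSMul₂ G X]

theorem measurableSet_fixes : MeasurableSet {p : (X × G) × G | (p.2 * p.1.2⁻¹) • p.1.1 ≠ p.1.1} :=
  (measurableSet_eq_fun ((measurable_snd.mul measurable_fst.snd.inv).smul measurable_fst.fst)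
    measurable_fst.fst).compl

theorem measurableSet_fixes_slice (x : X) (y : G) :
    MeasurableSet {k : G | (k * y⁻¹) • x ≠ x} :=
  (measurable_prodMk_left : Measurable fun k : G => ((x, y), k)) measurableSet_fixes

/-- Stabilizers are closed, so the elements of H that move x form an open subset of H, and Haar
measure charges every nonempty open set. -/
theorem condCoset_eq_zero_iff (H : ClosedSubgroup G) (x : X) (y : G) :
    H.condCoset y {k | (k * y⁻¹) • x ≠ x} = 0 ↔ H ≤ stab G x := by
  have hB := measurableSet_fixes_slice (G := G) x y
  have hopen : IsOpen {h : H.toSubgroup | (h : G) • x ≠ x} :=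
    (((stab G x).isClosed').isOpen_compl).preimage continuous_subtype_val
  have h1 : H.condCoset y {k | (k * y⁻¹) • x ≠ x} = 0 ↔
      H.cosetMeasure y {k | (k * y⁻¹) • x ≠ x} = 0 := by
    rw [condCoset, Measure.smul_apply, smul_eq_mul, mul_eq_zero,
      withDensity_apply_eq_zero measurable_weight]
    have : {k : G | weight G k ≠ 0} = Set.univ := Set.eq_univ_of_forall weight_ne_zero
    rw [this, Set.univ_inter]
    exact or_iff_right (ENNReal.inv_ne_zero.2 (H.lintegral_weight_ne_top y))
  have hpre : (fun h : H.toSubgroup => (h : G) * y) ⁻¹' {k | (k * y⁻¹) • x ≠ x} =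
      {h : H.toSubgroup | (h : G) • x ≠ x} := by
    ext h
    simp
  have h2 := hopen.measure_eq_zero_iff (μ := (Measure.haar : Measure H.toSubgroup))
  rw [h1, cosetMeasure, Measure.smul_apply, smul_eq_mul, mul_eq_zero,
    or_iff_right (ENNReal.inv_ne_zero.2 (H.scale_ne_top y)),
    Measure.map_apply (H.measurable_coe_mul y) hB, hpre, h2]
  constructor
  · intro h g hg
    by_contra hgx
    have : (⟨g, hg⟩ : H.toSubgroup) ∈ {h : H.toSubgroup | (h : G) • x ≠ x} := hgx
    rw [h] at this
    exact this
  · intro h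
    refine Set.eq_empty_of_forall_notMem fun k hk => hk (h k.2)

/-- Containment is expressed as the vanishing of a conditional probability, which is jointly
measurable, so measurability of `stab` itself is not required. -/
theorem measurableSet_le_stab :
    MeasurableSet {p : X × ClosedSubgroup G | p.2 ≤ stab G p.1} := by
  have := EffrosSpace.standardBorelSpace_of_locallyCompact G
  have hc : Measurable fun q : (X × ClosedSubgroup G) × G => (q.1.2, coset (q.1.2, q.2)) :=
    measurable_fst.snd.prodMk (measurable_coset.comp (measurable_fst.snd.prodMk measurable_snd))
  let κ : Kernel ((X × ClosedSubgroup G) × G) G := (cosetKernel G).condKernel.comap _ hc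
  have hS : MeasurableSet {r : ((X × ClosedSubgroup G) × G) × G |
      (r.2 * r.1.2⁻¹) • r.1.1.1 ≠ r.1.1.1} :=
    ((measurable_fst.fst.fst.prodMk measurable_fst.snd).prodMk measurable_snd :
      Measurable fun r : ((X × ClosedSubgroup G) × G) × G => ((r.1.1.1, r.1.2), r.2))
      measurableSet_fixes
  have hm : Measurable fun q => κ q {k | (k * q.2⁻¹) • q.1.1 ≠ q.1.1} :=
    Kernel.measurable_kernel_prodMk_left hS
  have hiff : ∀ p : X × ClosedSubgroup G, p.2 ≤ stab G p.1 ↔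
      ∫⁻ y, κ (p, y) {k | (k * y⁻¹) • p.1 ≠ p.1} ∂weightMeasure G = 0 := by
    intro p
    have h0 : ∫⁻ y, κ (p, y) {k | (k * y⁻¹) • p.1 ≠ p.1} ∂weightMeasure G =
        ∫⁻ y, p.2.condCoset y {k | (k * y⁻¹) • p.1 ≠ p.1} ∂weightMeasure G := by
      refine lintegral_congr_ae ?_
      filter_upwards [p.2.condKernel_ae_eq] with y hy
      exact congrArg (fun m : Measure G => m {k | (k * y⁻¹) • p.1 ≠ p.1}) hy
    constructor
    · intro h
      rw [h0]
      simp_rw [(p.2.condCoset_eq_zero_iff p.1 _).2 h, lintegral_zero]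
    · intro h
      replace h := (lintegral_eq_zero_iff (hm.comp measurable_prodMk_left)).1 h
      have hne : NeZero (weightMeasure G) := ⟨by
        rw [weightMeasure, Ne, withDensity_eq_zero_iff measurable_weight.aemeasurable]
        intro h
        obtain ⟨y, hy⟩ := h.exists
        exact weight_ne_zero y hy⟩
      -- A single y suffices: the criterion of `condCoset_eq_zero_iff` holds at every base point.
      obtain ⟨y, hy1, hy2⟩ := (h.and p.2.condKernel_ae_eq).exists
      refine (p.2.condCoset_eq_zero_iff p.1 y).1 ?_
      rw [← hy2]
      exact hy1
  simp_rw [hiff]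
  exact (hm.lintegral_prod_right' (ν := weightMeasure G)) (measurableSet_singleton 0)

end Stab

/-! ### Subgroups together with a closed set that they stabilize -/

/-- The law of the process of labelled cosets as a Markov kernel. -/
noncomputable def poissonKernel (G : Type*) [Group G] [TopologicalSpace G] [IsTopologicalGroup G]
    [T2Space G] [LocallyCompactSpace G] [SecondCountableTopology G] [MeasurableSpace G]
    [BorelSpace G] : Kernel (ClosedSubgroup G) (EffrosSpace (Labelled G)) :=
  ⟨poissonLaw, measurable_poissonLaw⟩

instance : IsMarkovKernel (poissonKernel G) :=
  ⟨fun H => inferInstanceAs (IsProbabilityMeasure H.poissonLaw)⟩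

/-- The law of a random subgroup with law `μ` and of a random closed set that it stabilizes. -/
noncomputable def withPoisson (μ : ProbabilityMeasure (ClosedSubgroup G)) :
    ProbabilityMeasure (ClosedSubgroup G × EffrosSpace (Labelled G)) :=
  ⟨(μ : Measure (ClosedSubgroup G)) ⊗ₘ poissonKernel G, inferInstance⟩

theorem withPoisson_apply (μ : ProbabilityMeasure (ClosedSubgroup G))
    {s : Set (ClosedSubgroup G × EffrosSpace (Labelled G))} (hs : MeasurableSet s) :
    (withPoisson μ : Measure (ClosedSubgroup G × EffrosSpace (Labelled G))) s =
      ∫⁻ H, H.poissonLaw (Prod.mk H ⁻¹' s) ∂(μ : Measure (ClosedSubgroup G)) :=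
  Measure.compProd_apply hs

theorem measurable_poissonLaw_slice {s : Set (ClosedSubgroup G × EffrosSpace (Labelled G))}
    (hs : MeasurableSet s) : Measurable fun H : ClosedSubgroup G =>
      H.poissonLaw (Prod.mk H ⁻¹' s) :=
  Kernel.measurable_kernel_prodMk_left (κ := poissonKernel G) hs

theorem measurable_withPoisson : Measurable (withPoisson (G := G)) := by
  refine measurable_probabilityMeasure fun s hs => ?_
  simp_rw [withPoisson_apply _ hs]
  exact (Measure.measurable_lintegral (measurable_poissonLaw_slice hs)).comp measurable_subtype_coe

/-- Translating both the subgroup and the closed set is consistent because the Poisson law of gHg⁻¹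
is the translate of that of H. -/
theorem withPoisson_smul (g : G) (μ : ProbabilityMeasure (ClosedSubgroup G)) :
    withPoisson (g • μ) = g • withPoisson μ := by
  refine Subtype.ext (Measure.ext fun s hs => ?_)
  have hg : Measurable fun p : ClosedSubgroup G × EffrosSpace (Labelled G) => g • p :=
    measurable_const_smul g
  have hgF : Measurable fun F : EffrosSpace (Labelled G) => g • F := measurable_const_smul g
  change (withPoisson (g • μ) : Measure (ClosedSubgroup G × EffrosSpace (Labelled G))) s =
    (withPoisson μ : Measure (ClosedSubgroup G × EffrosSpace (Labelled G))).map (g • ·) s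
  rw [Measure.map_apply hg hs, withPoisson_apply _ hs, withPoisson_apply _ (hg hs), coe_translate,
    lintegral_map (measurable_poissonLaw_slice hs) (measurable_const_smul g)]
  refine lintegral_congr fun H => ?_
  rw [poissonLaw_smul, Measure.map_apply hgF (measurable_prodMk_left hs)]
  rfl

theorem map_fst_withPoisson (μ : ProbabilityMeasure (ClosedSubgroup G)) :
    (withPoisson μ : Measure (ClosedSubgroup G × EffrosSpace (Labelled G))).map Prod.fst = μ :=
  Measure.fst_compProd _ _

theorem ae_withPoisson (μ : ProbabilityMeasure (ClosedSubgroup G))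
    {p : ClosedSubgroup G → Prop} (hp : MeasurableSet {H | p H})
    (h : ∀ᵐ H ∂(μ : Measure (ClosedSubgroup G)), p H) :
    ∀ᵐ q ∂(withPoisson μ : Measure (ClosedSubgroup G × EffrosSpace (Labelled G))),
      p q.1 ∧ IsStab q.1 q.2 := by
  refine (Measure.ae_compProd_iff ((measurable_fst hp).inter measurableSet_isStab)).2 ?_
  filter_upwards [h] with H hH
  filter_upwards [H.ae_isStab_poissonLaw] with F hF using ⟨hH, hF⟩

/-! ### Stabilizers -/

section Stabilizers

variable {X : Type*} [MeasurableSpace X] [StandardBorelSpace X] [MulAction G X]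
  [MeasurableSMul₂ G X]

theorem smul_eq_of_mem {g : G} {H : ClosedSubgroup G} (hg : g ∈ H) : g • H = H := by
  refine SetLike.coe_injective (Set.ext fun k => ?_)
  rw [coe_smul]
  constructor
  · rintro ⟨h, hh, rfl⟩
    exact mul_mem (mul_mem hg hh) (inv_mem hg)
  · intro hk
    exact ⟨g⁻¹ * k * g, mul_mem (mul_mem (inv_mem hg) hk) hg, by simp [mul_assoc]⟩

theorem IsStab.smul_eq_iff {H : ClosedSubgroup G} {F : EffrosSpace (Labelled G)}
    (hF : IsStab H F) {g : G} : g • F = F ↔ g ∈ H := by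
  constructor
  · intro hg
    refine hF.2 g fun x hx => ?_
    rw [← hg]
    exact EffrosSpace.smul_mem_smul.2 hx
  · intro hg
    refine SetLike.coe_injective (Set.ext fun x => ⟨fun hx => ?_, fun hx => ?_⟩)
    · simpa using hF.1 g hg _ (EffrosSpace.mem_smul.1 hx)
    · exact EffrosSpace.mem_smul.2 (hF.1 _ (inv_mem hg) x hx)

theorem stab_eq {x : X} {H : ClosedSubgroup G} {F : EffrosSpace (Labelled G)}
    (hx : H ≤ stab G x) (hF : IsStab H F) : stab G (x, H, F) = H := by
  refine SetLike.coe_injective (Set.ext fun g => ?_)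
  change g • (x, H, F) = (x, H, F) ↔ g ∈ H
  rw [Prod.smul_mk, Prod.smul_mk, Prod.mk.injEq, Prod.mk.injEq, hF.smul_eq_iff]
  exact ⟨fun h => h.2.2, fun h => ⟨hx h, smul_eq_of_mem h, h⟩⟩

/-- The skew product of `X` with the random subgroups `φ x` and their processes of labelled cosets
has the required stabilizers. -/
theorem exists_extension (ν : Measure X) (φ : X → ProbabilityMeasure (ClosedSubgroup G))
    (hν : IsQuasiInvariant G ν) (hφ : Measurable φ) (hφe : IsEquivariant G ν φ)
    (hle : ∀ᵐ x ∂ν, ∀ᵐ H ∂(φ x : Measure (ClosedSubgroup G)), H ≤ stab G x) :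
    ∃ η : Measure (X × ClosedSubgroup G × EffrosSpace (Labelled G)),
      IsQuasiInvariant G η ∧ IsGMap G η ν Prod.fst ∧
      IsRelativelyMeasurePreserving G η ν (Prod.fst : _ → X) ∧
      AEMeasurable (stab G : X × ClosedSubgroup G × EffrosSpace (Labelled G) → _) η ∧
      η.map (stab G) = barycenter (ν.map φ) := by
  have hκ : Measurable fun x => withPoisson (φ x) := measurable_withPoisson.comp hφ
  have hκe : IsEquivariant G ν fun x => withPoisson (φ x) := fun g => by
    filter_upwards [hφe g] with x hx
    rw [hx, withPoisson_smul]
  -- On a Borel set of full measure the stabilizer is the subgroup coordinate; this gives both the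
  -- almost everywhere measurability of `stab` and its law.
  have hstab : (stab G : X × ClosedSubgroup G × EffrosSpace (Labelled G) → _)
      =ᵐ[barycenter (ν.map (skew fun x => withPoisson (φ x)))] fun y => y.2.1 := by
    have hgood : MeasurableSet {y : X × ClosedSubgroup G × EffrosSpace (Labelled G) |
        y.2.1 ≤ stab G y.1 ∧ IsStab y.2.1 y.2.2} :=
      ((measurable_fst.prodMk measurable_snd.fst) measurableSet_le_stab).inter
        (measurable_snd measurableSet_isStab)
    have hae := ae_barycenter_map (ν := ν) (measurable_skew hκ) hgood (by
      filter_upwards [hle] with x hx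
      rw [coe_skew, ae_map_iff measurable_prodMk_left.aemeasurable hgood]
      exact ae_withPoisson (φ x) (measurable_prodMk_left measurableSet_le_stab) hx)
    filter_upwards [hae] with y hy
    exact stab_eq hy.1 hy.2
  refine ⟨barycenter (ν.map (skew fun x => withPoisson (φ x))),
    hν.barycenter_map (measurable_skew hκ) (isEquivariant_skew hκe), isGMap_skew hκ,
    ⟨_, isDisintegration_skew ν hκ, isEquivariant_skew hκe⟩,
    ⟨_, measurable_snd.fst, hstab⟩, ?_⟩
  rw [Measure.map_congr hstab]
  refine map_barycenter_map (measurable_skew hκ) hφ measurable_snd.fst fun x => ?_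
  rw [← Function.comp_def Prod.fst Prod.snd, ← Measure.map_map measurable_fst measurable_snd,
    map_snd_skew, map_fst_withPoisson]

end Stabilizers

end ClosedSubgroup

/-! ### The theorem -/

theorem theoremT {G : Type v} [Group G] [TopologicalSpace G] [IsTopologicalGroup G]
    [T2Space G] [LocallyCompactSpace G] [SecondCountableTopology G] [MeasurableSpace G]
    [BorelSpace G] :
    (∀ (X : Type u) [MeasurableSpace X] [StandardBorelSpace X] [MulAction G X]
        [MeasurableSMul₂ G X] (ν : Measure X) (φ : X → ProbabilityMeasure (ClosedSubgroup G)),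
        IsQuasiInvariant G ν → Measurable φ → IsEquivariant G ν φ →
        (∀ᵐ x ∂ν, ∀ᵐ H ∂(φ x : Measure (ClosedSubgroup G)), H ≤ stab G x) →
        ∃ (Y : Type (max u v)) (_ : MeasurableSpace Y) (_ : StandardBorelSpace Y)
          (_ : MulAction G Y) (_ : MeasurableSMul₂ G Y) (η : Measure Y) (π : Y → X),
          IsQuasiInvariant G η ∧ IsGMap G η ν π ∧ IsRelativelyMeasurePreserving G η ν π ∧
          AEMeasurable (stab G : Y → ClosedSubgroup G) η ∧
          η.map (stab G) = barycenter (ν.map φ)) ∧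
    (∀ ρ : Measure (ClosedSubgroup G), IsQuasiInvariant G ρ →
        ∃ (Y : Type v) (_ : MeasurableSpace Y) (_ : StandardBorelSpace Y)
          (_ : MulAction G Y) (_ : MeasurableSMul₂ G Y) (η : Measure Y),
          IsQuasiInvariant G η ∧ AEMeasurable (stab G : Y → ClosedSubgroup G) η ∧
          η.map (stab G) = ρ) := by

  refine ⟨fun X _ _ _ _ ν φ hν hφ hφe hle => ?_, fun ρ hρ => ?_⟩
  · obtain ⟨η, h⟩ := ClosedSubgroup.exists_extension ν φ hν hφ hφe hle
    exact ⟨_, _, inferInstance, _, inferInstance, η, Prod.fst, h⟩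
  -- A closed subgroup is contained in its normalizer, which is its stabilizer under conjugation, so
  -- point masses on S(G) satisfy the hypothesis of the first part.
  · let φ : ClosedSubgroup G → ProbabilityMeasure (ClosedSubgroup G) := fun H =>
      ⟨Measure.dirac H, inferInstance⟩
    have hφ : Measurable φ := Measure.measurable_dirac.subtype_mk
    obtain ⟨η, hη, -, -, hm, hs⟩ := ClosedSubgroup.exists_extension ρ φ hρ hφ
      (fun g => Eventually.of_forall fun H => Subtype.ext
        (Measure.map_dirac' (measurable_const_smul g) H).symm)
      (Eventually.of_forall fun H => by
        have hm : MeasurableSet {H' : ClosedSubgroup G | H' ≤ stab G H} :=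
          measurable_prodMk_left ClosedSubgroup.measurableSet_le_stab
        exact (mem_ae_dirac_iff hm).2 fun g hg => ClosedSubgroup.smul_eq_of_mem hg)
    refine ⟨_, _, inferInstance, _, inferInstance, η, hη, hm, hs.trans ?_⟩
    ext s hs
    rw [barycenter_map_apply hφ hs]
    change ∫⁻ H, Measure.dirac H s ∂ρ = ρ s
    simp_rw [Measure.dirac_apply' _ hs]
    exact lintegral_indicator_one hs
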